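/- Let $\Omega\subset\mathbb R^2$ be compact and convex, let $X:=\Omega\cap\mathbb Z^2$, and let $\mathrm{Conv}(X)$ be the set of restrictions to $X$ of convex functions $U:\Omega\to\mathbb R$. A vector $e=(\alpha,\beta)\in\mathbb Z^2$ is irreducible if $\gcd(\alpha,\beta)=1$. For each irreducible $e$ with $\|e\|>1$ there is exactly one pair $(f,g)\in(\mathbb Z^2)^2$ with $e=f+g$, $\det(f,g)=1$ and $\langle f,g\rangle\ge 0$; $f,g$ are called the parents of $e$. Unit vectors have no parents. For $x\in X$ and $e$ irreducible (with $\|e\|>1$ and parents $f,g$ in the last two cases) put $$S_x^e(u)=u(x+e)-2u(x)+u(x-e),$$ $$T_x^e(u)=u(x+e)+u(x-f)+u(x-g)-3u(x),$$ $$P_x^e(u)=u(x+e)-u(x+f)-u(x+g)+u(x).$$ Such a form is defined on functions $u:X\to\mathbb R$ whenever it is supported in $X$, i.e. all the points at which it evaluates $u$ lie in $X$. For $x\in X$ let $\mathcal V_{\max}(x)$ be the set of irreducible $e\in\mathbb Z^2$ with $x+e\in X$. A family of stencils on $X$ is a family $\mathcal V=(\mathcal V(x))_{x\in X}$ of sets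 $\mathcal V(x)\subset\mathcal V_{\max}(x)$ such that, for every $x\in X$: (Stability) every parent of an element of $\mathcal V(x)$ that belongs to $\mathcal V_{\max}(x)$ belongs to $\mathcal V(x)$; (Visibility) $\mathcal V(x)$ and $\mathcal V_{\max}(x)$ generate the same convex cone in $\mathbb R^2$ (the cone generated by $\emptyset$ being $\{0\}$). Let $\hat{\mathcal V}(x)$ be the set of $e\in\mathcal V_{\max}(x)\setminus\mathcal V(x)$ that have two parents, both in $\mathcal V(x)$. Let $\mathrm{Conv}(\mathcal V)$ be the set of $u:X\to\mathbb R$ such that, for every $x\in X$: $S_x^e(u)\ge0$ for all $e\in\mathcal V(x)$ such that $S_x^e$ is supported in $X$; $T_x^e(u)\ge 0$ for all $e\in\mathcal V(x)$ with $\|e\|>1$ such that $T_x^e$ is supported in $X$; and $P_x^e(u)\ge0$ for all $e\in\hat{\mathcal V}(x)$. Then, for any family $\mathcal V$ of stencils on $X$, every $e\in\mathcal V_{\max}(x)\setminus\mathcal V(x)$, $x\in X$, has parents and $P_x^e$ is supported in $X$, and $$\mathrm{Conv}(\mathcal V)=\{u\in\mathrm{Conv}(X):\ P_x^e(u)\ge0\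 \text{for all }x\in X\text{ and all }e\in\mathcal V_{\max}(x)\setminus\mathcal V(x)\}.$$ -/

import Mathlib

namespace DiscreteConvex

/-- The inclusion of `ℤ²` in `ℝ²`. -/
def toPlane (z : ℤ × ℤ) : ℝ × ℝ := ((z.1 : ℝ), (z.2 : ℝ))

/-- The grid points of the domain `Ω`: `X = Ω ∩ ℤ²`. -/
def grid (Ω : Set (ℝ × ℝ)) : Set (ℤ × ℤ) := {z | toPlane z ∈ Ω}

/-- A vector of `ℤ²` is irreducible iff its coordinates have greatest common divisor one. -/
def Irred (e : ℤ × ℤ) : Prop := Int.gcd e.1 e.2 = 1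

/-- `f, g` are the parents of `e`: `(f, g)` is a direct (`det (f, g) = 1`) and acute
(`⟨f, g⟩ ≥ 0`) basis of `ℤ²`, and `e = f + g`. Such an `e` is irreducible and is not a unit
vector; conversely every irreducible `e` with `‖e‖ > 1` has exactly one such pair. -/
def IsParents (f g e : ℤ × ℤ) : Prop :=
  f.1 * g.2 - f.2 * g.1 = 1 ∧ 0 ≤ f.1 * g.1 + f.2 * g.2 ∧ f + g = e

section Forms

variable {X : Set (ℤ × ℤ)}

/-- The segment form `S_x^e(u) = u(x+e) - 2 u(x) + u(x-e)`, given that it is supported in `X`. -/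
def segForm (u : X → ℝ) (x : X) (e : ℤ × ℤ) (he : (x : ℤ × ℤ) + e ∈ X)
    (he' : (x : ℤ × ℤ) - e ∈ X) : ℝ :=
  u ⟨x + e, he⟩ - 2 * u x + u ⟨x - e, he'⟩

/-- The triangle form `T_x^e(u) = u(x+e) + u(x-f) + u(x-g) - 3 u(x)`, where `f, g` are the parents
of `e`, given that it is supported in `X`. -/
def triForm (u : X → ℝ) (x : X) (e f g : ℤ × ℤ) (he : (x : ℤ × ℤ) + e ∈ X)
    (hf : (x : ℤ × ℤ) - f ∈ X) (hg : (x : ℤ × ℤ) - g ∈ X) : ℝ :=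
  u ⟨x + e, he⟩ + u ⟨x - f, hf⟩ + u ⟨x - g, hg⟩ - 3 * u x

/-- The parallelogram form `P_x^e(u) = u(x+e) - u(x+f) - u(x+g) + u(x)`, where `f, g` are the
parents of `e`, given that it is supported in `X`. -/
def parForm (u : X → ℝ) (x : X) (e f g : ℤ × ℤ) (he : (x : ℤ × ℤ) + e ∈ X)
    (hf : (x : ℤ × ℤ) + f ∈ X) (hg : (x : ℤ × ℤ) + g ∈ X) : ℝ :=
  u ⟨x + e, he⟩ - u ⟨x + f, hf⟩ - u ⟨x + g, hg⟩ + u x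

end Forms

/-- The maximal stencil at `x`: the irreducible `e` with `x + e ∈ X`. -/
def maxStencil (X : Set (ℤ × ℤ)) (x : X) : Set (ℤ × ℤ) := {e | Irred e ∧ (x : ℤ × ℤ) + e ∈ X}

/-- The convex cone of `ℝ²` generated by a set of integer vectors; it is `{0}` for the empty
set. -/
def cone (A : Set (ℤ × ℤ)) : PointedCone ℝ (ℝ × ℝ) := PointedCone.hull ℝ (toPlane '' A)

/-- `V = (V(x))_{x ∈ X}` is a family of stencils on `X`. -/
structure IsStencilFamily (X : Set (ℤ × ℤ)) (V : X → Set (ℤ × ℤ)) : Prop where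
  subset_max : ∀ x, V x ⊆ maxStencil X x
  /-- Each parent, of a member of `V x`, that lies in the maximal stencil lies in `V x`. -/
  stability : ∀ x, ∀ e ∈ V x, ∀ f g, IsParents f g e →
    (f ∈ maxStencil X x → f ∈ V x) ∧ (g ∈ maxStencil X x → g ∈ V x)
  visibility : ∀ x, cone (V x) = cone (maxStencil X x)

/-- The candidates for refinement at `x`: the members of the maximal stencil, outside of `V x`,
whose two parents belong to `V x`. -/
def candidates (X : Set (ℤ × ℤ)) (V : X → Set (ℤ × ℤ)) (x : X) : Set (ℤ × ℤ) :=
  {e | e ∈ maxStencil X x ∧ e ∉ V x ∧ ∃ f g, IsParents f g e ∧ f ∈ V x ∧ g ∈ V x}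

/-- `Conv(X)`: the restrictions to `X = Ω ∩ ℤ²` of the convex functions on `Ω`. -/
def convGrid (Ω : Set (ℝ × ℝ)) : Set (grid Ω → ℝ) :=
  {u | ∃ U : ℝ × ℝ → ℝ, ConvexOn ℝ Ω U ∧ ∀ x : grid Ω, u x = U (toPlane x)}

/-- `Conv(V)`: the functions `u` on `X` such that, for all `x ∈ X`, one has `S_x^e(u) ≥ 0` for all
`e ∈ V(x)` and `T_x^e(u) ≥ 0` for all `e ∈ V(x)` with `‖e‖ > 1` (that is, having parents), whenever
these forms are supported in `X`, and `P_x^e(u) ≥ 0` for all candidates for refinement `e` at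
`x`. -/
def convStencil (X : Set (ℤ × ℤ)) (V : X → Set (ℤ × ℤ)) : Set (X → ℝ) :=
  {u | ∀ x : X,
    (∀ e ∈ V x, ∀ (he : (x : ℤ × ℤ) + e ∈ X) (he' : (x : ℤ × ℤ) - e ∈ X),
      0 ≤ segForm u x e he he') ∧
    (∀ e ∈ V x, ∀ f g, IsParents f g e → ∀ (he : (x : ℤ × ℤ) + e ∈ X)
      (hf : (x : ℤ × ℤ) - f ∈ X) (hg : (x : ℤ × ℤ) - g ∈ X), 0 ≤ triForm u x e f g he hf hg) ∧
    (∀ e ∈ candidates X V x, ∀ f g, IsParents f g e → ∀ (he : (x : ℤ × ℤ) + e ∈ X)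
      (hf : (x : ℤ × ℤ) + f ∈ X) (hg : (x : ℤ × ℤ) + g ∈ X), 0 ≤ parForm u x e f g he hf hg)}

end DiscreteConvex

open DiscreteConvex

/-! From `Conv(V)` to all forms: let `(f, g)` be the parents of `e`. If `‖g‖ < ‖f‖`, then `(f - g,
g)` are the parents of `f`, and `P_x^e = P_x^f + S_{x+f}^g`; the case `‖f‖ < ‖g‖` is symmetric. Also
`S_x^e = P_x^e + P_x^{-e} + S_x^f + S_x^g` and `T_x^e = P_x^e + S_x^f + S_x^g`. By induction on
`‖e‖²` (`par_nonneg_and_seg_nonneg`), `P ≥ 0` outside the stencils and `S ≥ 0` everywhere; then `T ≥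
0` follows. The supports are controlled by `parents_mem_maxStencil`. Stability yields a Stern-Brocot
descent (`mem_stencil_of_comb_mem`), by which no stencil member lies strictly between the parents of
some `e ∉ V(x)`. Visibility provides members beyond each parent, so `x + f` and `x + g` lie in
triangles with vertices in `Ω`.

From `S, T ≥ 0` to convexity: compare `u` with its lower convex envelope. If the gap is positive
somewhere, take `x` of maximal gap and, among those, of maximal norm. Let `K` be the hull of the
points that carry an optimal average at `x`. Shrinking lattice triangles in `K` gives `h₁ + h₂ + h₃
= 0` with `x + hᵢ ∈ K`, either `h, -h, 0` or a superbase (`HasBalancedTriple`). A form `S` or `T`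
bounds `3 u(x)` by `∑ u(x + hᵢ)`, while optimality bounds `∑ env(x + hᵢ)` by `3 env(x)`. So the
three gaps are maximal too, although `∑ ‖x + hᵢ‖² > 3 ‖x‖²`: a contradiction. Farkas' lemma then
supplies an affine minorant exact at each point, and their maximum extends `u`. The converse
inclusion is Jensen's inequality. -/

namespace DiscreteConvex

/-! ### Lattice bases, parents and lattice points of triangles -/

/-- The determinant of a pair of integer vectors. -/
def cross (p q : ℤ × ℤ) : ℤ := p.1 * q.2 - p.2 * q.1

/-- The scalar product of a pair of integer vectors. -/
def dot (p q : ℤ × ℤ) : ℤ := p.1 * q.1 + p.2 * q.2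

theorem exists_bezout {a c : ℤ} (ha : 1 ≤ a) (hc : 1 ≤ c) (h : IsCoprime a c) :
    ∃ p q, a * q - c * p = 1 ∧ 0 ≤ p ∧ p < a ∧ 1 ≤ q ∧ q ≤ c := by
  obtain ⟨m, n, hmn⟩ := h
  have hk := Int.emod_add_mul_ediv (-n) a
  have h0 := Int.emod_nonneg (-n) (by omega : a ≠ 0)
  have h1 := Int.emod_lt_of_pos (-n) (by omega : 0 < a)
  generalize -n % a = p at *
  generalize -n / a = k at *
  have e : a * (m - c * k) - c * p = 1 := by linear_combination hmn - c * hk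
  refine ⟨p, m - c * k, e, h0, h1, ?_, ?_⟩ <;> generalize m - c * k = q at e
  · by_contra hq
    nlinarith
  · by_contra hq
    nlinarith

theorem irred_iff_isCoprime {e : ℤ × ℤ} : Irred e ↔ IsCoprime e.1 e.2 :=
  Int.isCoprime_iff_gcd_eq_one.symm

theorem Irred.neg {e : ℤ × ℤ} (h : Irred e) : Irred (-e) := by
  simpa [Irred] using h

theorem irred_left_of_cross {p q : ℤ × ℤ} (h : cross p q = 1 ∨ cross p q = -1) : Irred p := by
  rw [irred_iff_isCoprime]
  unfold cross at h
  rcases h with h | h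
  · exact ⟨q.2, -q.1, by linear_combination h⟩
  · exact ⟨-q.2, q.1, by linear_combination -h⟩

theorem irred_right_of_cross {p q : ℤ × ℤ} (h : cross p q = 1 ∨ cross p q = -1) : Irred q := by
  rw [irred_iff_isCoprime]
  unfold cross at h
  rcases h with h | h
  · exact ⟨-p.2, p.1, by linear_combination h⟩
  · exact ⟨p.2, -p.1, by linear_combination -h⟩

theorem IsParents.neg {f g e : ℤ × ℤ} (h : IsParents f g e) : IsParents (-f) (-g) (-e) := by
  obtain ⟨h1, h2, rfl⟩ := h
  refine ⟨?_, ?_, by abel⟩ <;> simpa using by assumption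

theorem IsParents.irred {f g e : ℤ × ℤ} (h : IsParents f g e) :
    Irred f ∧ Irred g ∧ Irred e := by
  obtain ⟨h1, h2, rfl⟩ := h
  refine ⟨irred_left_of_cross (q := g) (Or.inl h1), irred_right_of_cross (p := f) (Or.inl h1),
    irred_right_of_cross (p := f) (Or.inl ?_)⟩
  simp only [cross, Prod.fst_add, Prod.snd_add]
  linear_combination h1

/-- The parents of a positive combination of an acute basis are combinations of that basis with
nonnegative coefficients. -/
theorem exists_parents_in_basis {r s e : ℤ × ℤ} {a c : ℤ}
    (hrs : cross r s = 1 ∨ cross r s = -1) (hac : 0 ≤ dot r s) (ha : 1 ≤ a) (hc : 1 ≤ c)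
    (he : e = a • r + c • s) (hirr : Irred e) :
    ∃ p q, a * q - c * p = 1 ∧ 0 ≤ p ∧ p < a ∧ 1 ≤ q ∧ q ≤ c ∧
      (IsParents ((a - p) • r + (c - q) • s) (p • r + q • s) e ∨
        IsParents (p • r + q • s) ((a - p) • r + (c - q) • s) e) := by
  have hco : IsCoprime a c := by
    obtain ⟨m, n, hmn⟩ := irred_iff_isCoprime.1 hirr
    rw [he] at hmn
    simp only [Prod.fst_add, Prod.snd_add, Prod.smul_fst, Prod.smul_snd, smul_eq_mul] at hmn
    exact ⟨m * r.1 + n * r.2, m * s.1 + n * s.2, by linear_combination hmn⟩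
  obtain ⟨p, q, h, hp0, hpa, hq1, hqc⟩ := exists_bezout ha hc hco
  refine ⟨p, q, h, hp0, hpa, hq1, hqc, ?_⟩
  -- The scalar product of the two parts of `e`, expanded in the basis: every coefficient is
  -- nonnegative, so they form an acute pair.
  have hdot : 0 ≤ (a - p) * p * (r.1 ^ 2 + r.2 ^ 2) + ((a - p) * q + (c - q) * p) * dot r s +
      (c - q) * q * (s.1 ^ 2 + s.2 ^ 2) := by
    have := mul_nonneg (sub_nonneg.2 hpa.le) hp0
    have := mul_nonneg (sub_nonneg.2 hqc) (zero_le_one.trans hq1)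
    have := mul_nonneg (sub_nonneg.2 hpa.le) (zero_le_one.trans hq1)
    have := mul_nonneg (sub_nonneg.2 hqc) hp0
    positivity
  unfold cross at hrs
  unfold dot at hdot
  rcases hrs with hrs | hrs
  · left
    refine ⟨?_, ?_, by rw [he]; module⟩ <;>
      simp only [Prod.fst_add, Prod.snd_add, Prod.smul_fst, Prod.smul_snd, smul_eq_mul]
    · linear_combination (a * q - c * p) * hrs + h
    · linarith
  · right
    refine ⟨?_, ?_, by rw [he]; module⟩ <;>
      simp only [Prod.fst_add, Prod.snd_add, Prod.smul_fst, Prod.smul_snd, smul_eq_mul]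
    · linear_combination -(a * q - c * p) * hrs + h
    · linarith

/-- Membership in the triangle `x, x + s, x + t`, with denominators cleared so that its side
conditions are integer arithmetic. -/
theorem mem_of_convex_comb {K : Set (ℝ × ℝ)} (hK : Convex ℝ K) {x s t w : ℤ × ℤ}
    (hx : toPlane x ∈ K) (hs : toPlane (x + s) ∈ K) (ht : toPlane (x + t) ∈ K) {α β n : ℤ}
    (hα : 0 ≤ α) (hβ : 0 ≤ β) (hn : 0 < n) (hle : α + β ≤ n) (h : n • w = α • s + β • t) :
    toPlane (x + w) ∈ K := by
  have hn' : (0 : ℝ) < n := by exact_mod_cast hn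
  have hle' : (α : ℝ) + β ≤ n := by exact_mod_cast hle
  have hα' : (0 : ℝ) ≤ α := by exact_mod_cast hα
  have hβ' : (0 : ℝ) ≤ β := by exact_mod_cast hβ
  have h1 : (n : ℝ) * w.1 = α * s.1 + β * t.1 := by
    have := congrArg Prod.fst h
    simp only [Prod.fst_add, Prod.smul_fst, smul_eq_mul] at this
    exact_mod_cast this
  have h2 : (n : ℝ) * w.2 = α * s.2 + β * t.2 := by
    have := congrArg Prod.snd h
    simp only [Prod.snd_add, Prod.smul_snd, smul_eq_mul] at this
    exact_mod_cast this
  have key := hK.sum_mem (t := (Finset.univ : Finset (Fin 3))) (w := ![((n : ℝ) - α - β) / n, (α : ℝ) / n, (β : ℝ) / n])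
    (z := ![toPlane x, toPlane (x + s), toPlane (x + t)])
    (by
      intro i _
      fin_cases i
      · exact div_nonneg (by linarith) hn'.le
      · exact div_nonneg hα' hn'.le
      · exact div_nonneg hβ' hn'.le)
    (by simp [Fin.sum_univ_three]; field_simp; ring)
    (by intro i _; fin_cases i <;> assumption)
  convert key using 1
  simp only [Fin.sum_univ_three, Matrix.cons_val_zero, Matrix.cons_val_one, Matrix.cons_val]
  ext
  · simp [toPlane]
    field_simp
    linear_combination h1
  · simp [toPlane]
    field_simp
    linear_combination h2

/-! ### Consequences of stability and visibility -/

section Stencils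

variable {Ω : Set (ℝ × ℝ)} {V : grid Ω → Set (ℤ × ℤ)}

/-- Descent along the Stern-Brocot tree: if a stencil has a member in the cone of an acute basis
`(r, s)`, off the ray of `r`, and if `s` is in the maximal stencil, then `s` is in the stencil. -/
theorem mem_stencil_of_comb_mem (hconv : Convex ℝ Ω) (hV : IsStencilFamily (grid Ω) V)
    (x : grid Ω) {r s : ℤ × ℤ} (hrs : cross r s = 1 ∨ cross r s = -1) (hac : 0 ≤ dot r s)
    (hs : s ∈ maxStencil (grid Ω) x) {a c : ℤ} (ha : 0 ≤ a) (hc : 1 ≤ c)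
    (he : a • r + c • s ∈ V x) : s ∈ V x := by
  obtain ⟨n, hn⟩ : ∃ n : ℕ, a ≤ n := ⟨a.toNat, Int.self_le_toNat a⟩
  induction n generalizing a c with
  | zero =>
    obtain rfl : a = 0 := by push_cast at hn; omega
    have hirr := irred_iff_isCoprime.1 (hV.subset_max x he).1
    obtain ⟨m, n, hmn⟩ := hirr
    simp only [Prod.fst_add, Prod.snd_add, Prod.smul_fst, Prod.smul_snd, smul_eq_mul] at hmn
    obtain rfl : c = 1 :=
      Int.eq_one_of_dvd_one (by omega) ⟨m * s.1 + n * s.2, by linear_combination -hmn⟩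
    simpa using he
  | succ n ih =>
    rcases ha.eq_or_lt with rfl | ha
    · exact ih le_rfl hc he (by positivity)
    obtain ⟨p, q, h, hp0, hpa, hq1, hqc, hpar⟩ :=
      exists_parents_in_basis hrs hac ha hc rfl (hV.subset_max x he).1
    have hmax : p • r + q • s ∈ maxStencil (grid Ω) x := by
      refine ⟨?_, ?_⟩
      · rcases hpar with hpar | hpar
        · exact hpar.irred.2.1
        · exact hpar.irred.1
      -- As `a q - c p = 1`, the parent nearer to `s` satisfies `a (p r + q s) = s + p e`, and `1 +
      -- p ≤ a`: it lies in the triangle `0, s, e`.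
      · refine mem_of_convex_comb hconv x.2 hs.2 (hV.subset_max x he).2 (α := 1) (β := p) (n := a)
          (by norm_num) hp0 ha (by omega) ?_
        have : a * q = 1 + c * p := by linear_combination h
        rw [smul_add, smul_smul, smul_smul, this]
        module
    have hmem : p • r + q • s ∈ V x := by
      rcases hpar with hpar | hpar
      · exact (hV.stability x _ he _ _ hpar).2 hmax
      · exact (hV.stability x _ he _ _ hpar).1 hmax
    exact ih hp0 hq1 hmem (by push_cast at hn; omega)

/-- A linear form that is positive at a member of the maximal stencil is positive at a member of
the stencil. -/
theorem exists_mem_stencil_pos (hV : IsStencilFamily (grid Ω) V) (x : grid Ω) {e : ℤ × ℤ}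
    (he : e ∈ maxStencil (grid Ω) x) (m n : ℤ) (hpos : 0 < m * e.1 + n * e.2) :
    ∃ a ∈ V x, 0 < m * a.1 + n * a.2 := by
  by_contra! hcon
  have h : ∀ y ∈ cone (V x), (m : ℝ) * y.1 + n * y.2 ≤ 0 := by
    intro y hy
    refine Submodule.span_induction (p := fun y _ => (m : ℝ) * y.1 + n * y.2 ≤ 0)
      ?_ ?_ ?_ ?_ hy
    · rintro _ ⟨a, ha, rfl⟩
      have := hcon a ha
      simp only [toPlane]
      exact_mod_cast this
    · simp
    · intro y z _ _ hy hz
      simp only [Prod.fst_add, Prod.snd_add]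
      linarith
    · rintro ⟨t, ht⟩ y _ hy
      have : (m : ℝ) * (t * y.1) + n * (t * y.2) ≤ 0 := by nlinarith
      exact this
  have h' := h (toPlane e) (by
    rw [hV.visibility x]
    exact PointedCone.subset_hull (Set.mem_image_of_mem _ he))
  simp only [toPlane] at h'
  have h'' : m * e.1 + n * e.2 ≤ 0 := by exact_mod_cast h'
  omega

/-- Visibility gives a stencil member `a` with `⟨e, a⟩ > 0`. It lies in the cone of `e` and a unit
vector orthogonal to `e`, off the ray of the latter, so the descent reaches `e`. -/
theorem unit_mem_stencil (hconv : Convex ℝ Ω) (hV : IsStencilFamily (grid Ω) V)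
    (x : grid Ω) {e : ℤ × ℤ} (he : e ∈ maxStencil (grid Ω) x) (h1 : dot e e = 1) : e ∈ V x := by
  obtain ⟨a, ha, hpos⟩ := exists_mem_stencil_pos hV x he e.1 e.2 (by unfold dot at h1; omega)
  unfold dot at h1
  rcases le_total 0 (cross e a) with h | h
  · refine mem_stencil_of_comb_mem hconv hV x (r := (-e.2, e.1)) (s := e) (Or.inr ?_) ?_ he h hpos ?_
    · simp only [cross]; linear_combination -h1
    · simp only [dot]; linarith
    · convert ha using 1
      ext <;> simp [cross]
      · linear_combination a.1 * h1
      · linear_combination a.2 * h1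
  · refine mem_stencil_of_comb_mem hconv hV x (r := (e.2, -e.1)) (s := e) (Or.inl ?_) ?_ he
      (neg_nonneg.2 h) hpos ?_
    · simp only [cross]; linear_combination h1
    · simp only [dot]; linarith
    · convert ha using 1
      ext <;> simp [cross]
      · linear_combination a.1 * h1
      · linear_combination a.2 * h1

/-- An irreducible vector on a coordinate axis is a unit vector; otherwise the signed standard basis
of the quadrant of `e` is an acute basis to split `e` in. -/
theorem Irred.exists_isParents {e : ℤ × ℤ} (he : Irred e) (h1 : dot e e ≠ 1) :
    ∃ f g, IsParents f g e := by
  have key : ∀ σ τ : ℤ, (σ = 1 ∨ σ = -1) → (τ = 1 ∨ τ = -1) → 1 ≤ σ * e.1 → 1 ≤ τ * e.2 →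
      ∃ f g, IsParents f g e := by
    intro σ τ hσ hτ h1 h2
    obtain ⟨p, q, -, -, -, -, -, h | h⟩ :=
      exists_parents_in_basis (r := (σ, 0)) (s := (0, τ)) (e := e)
        (by rcases hσ with rfl | rfl <;> rcases hτ with rfl | rfl <;> simp [cross])
        (by simp [dot]) h1 h2
        (by rcases hσ with rfl | rfl <;> rcases hτ with rfl | rfl <;> ext <;> simp) he
    exacts [⟨_, _, h⟩, ⟨_, _, h⟩]
  have hne1 : e.1 ≠ 0 := by
    intro h0
    rw [Irred, h0, Int.gcd_zero_left] at he
    apply h1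
    rw [dot, h0]
    rcases Int.natAbs_eq e.2 with h | h <;> rw [h, he] <;> norm_num
  have hne2 : e.2 ≠ 0 := by
    intro h0
    rw [Irred, h0, Int.gcd_zero_right] at he
    apply h1
    rw [dot, h0]
    rcases Int.natAbs_eq e.1 with h | h <;> rw [h, he] <;> norm_num
  rcases lt_or_gt_of_ne hne1 with h | h <;> rcases lt_or_gt_of_ne hne2 with h' | h'
  · exact key (-1) (-1) (by simp) (by simp) (by omega) (by omega)
  · exact key (-1) 1 (by simp) (by simp) (by omega) (by omega)
  · exact key 1 (-1) (by simp) (by simp) (by omega) (by omega)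
  · exact key 1 1 (by simp) (by simp) (by omega) (by omega)

/-- Outside of the stencil, the parents of a member of the maximal stencil are in the maximal
stencil. -/
theorem parents_mem_maxStencil (hconv : Convex ℝ Ω) (hV : IsStencilFamily (grid Ω) V)
    (x : grid Ω) {e f g : ℤ × ℤ} (he : e ∈ maxStencil (grid Ω) x) (heV : e ∉ V x)
    (hp : IsParents f g e) : f ∈ maxStencil (grid Ω) x ∧ g ∈ maxStencil (grid Ω) x := by
  obtain ⟨hdet, hdot, rfl⟩ := id hp
  -- Since `a = cross a g • f + cross f a • g`, such an `a` would lie in the cone of `(f, e)` or of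
  -- `(g, e)`, off the ray of `f` or `g`, and the descent would put `e` in the stencil.
  have hout : ∀ a ∈ V x, ¬ (0 < cross a g ∧ 0 < cross f a) := by
    rintro a ha ⟨h1, h2⟩
    apply heV
    rcases le_total (cross f a) (cross a g) with h | h
    · refine mem_stencil_of_comb_mem hconv hV x (r := f) (Or.inl ?_) ?_ he
        (sub_nonneg.2 h) h2 ?_
      · simp only [cross, Prod.fst_add, Prod.snd_add]; linear_combination hdet
      · simp only [dot, Prod.fst_add, Prod.snd_add]
        nlinarith [sq_nonneg f.1, sq_nonneg f.2, sq_nonneg g.1, sq_nonneg g.2]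
      · convert ha using 1
        ext <;> simp [cross]
        · linear_combination a.1 * hdet
        · linear_combination a.2 * hdet
    · refine mem_stencil_of_comb_mem hconv hV x (r := g) (Or.inr ?_) ?_ he
        (sub_nonneg.2 h) h1 ?_
      · simp only [cross, Prod.fst_add, Prod.snd_add]; linear_combination -hdet
      · simp only [dot, Prod.fst_add, Prod.snd_add]
        nlinarith [sq_nonneg f.1, sq_nonneg f.2, sq_nonneg g.1, sq_nonneg g.2]
      · convert ha using 1
        ext <;> simp [cross]
        · linear_combination a.1 * hdet
        · linear_combination a.2 * hdet
  refine ⟨⟨hp.irred.1, ?_⟩, ⟨hp.irred.2.1, ?_⟩⟩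
  -- The form is `cross · g`, equal to 1 at `e`. By `hout` the member `a` is not on the `g` side of
  -- `f`, so `f` lies in the triangle `0, e, a`.
  · obtain ⟨a, ha, hpos⟩ := exists_mem_stencil_pos hV x he g.2 (-g.1) (by
      simp only [Prod.fst_add, Prod.snd_add]; linarith)
    have h1 : 0 < cross a g := by unfold cross; linarith
    have h2 : cross f a ≤ 0 := by
      by_contra h2
      exact hout a ha ⟨h1, not_le.1 h2⟩
    refine mem_of_convex_comb hconv x.2 he.2 (hV.subset_max x ha).2 (α := -cross f a) (β := 1)
      (n := cross a g - cross f a) (by omega) zero_le_one (by omega) (by omega) ?_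
    ext <;> simp [cross]
    · linear_combination a.1 * hdet
    · linear_combination a.2 * hdet
  · obtain ⟨a, ha, hpos⟩ := exists_mem_stencil_pos hV x he (-f.2) f.1 (by
      simp only [Prod.fst_add, Prod.snd_add]; linarith)
    have h1 : 0 < cross f a := by unfold cross; linarith
    have h2 : cross a g ≤ 0 := by
      by_contra h2
      exact hout a ha ⟨not_le.1 h2, h1⟩
    refine mem_of_convex_comb hconv x.2 he.2 (hV.subset_max x ha).2 (α := -cross a g) (β := 1)
      (n := cross f a - cross a g) (by omega) zero_le_one (by omega) (by omega) ?_
    ext <;> simp [cross]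
    · linear_combination a.1 * hdet
    · linear_combination a.2 * hdet

end Stencils

/-! ### Norms of parents, and parents of parents -/

theorem Irred.dot_self_pos {e : ℤ × ℤ} (he : Irred e) : 0 < dot e e := by
  have h0 : e ≠ 0 := by rintro rfl; simp [Irred] at he
  unfold dot
  by_contra h
  apply h0
  ext
  · simp only [Prod.fst_zero]; nlinarith [mul_self_nonneg e.1, mul_self_nonneg e.2]
  · simp only [Prod.snd_zero]; nlinarith [mul_self_nonneg e.1, mul_self_nonneg e.2]

theorem dot_self_mul_dot_self {f g : ℤ × ℤ} (h : f.1 * g.2 - f.2 * g.1 = 1) :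
    dot f f * dot g g = 1 + dot f g ^ 2 := by
  unfold dot
  linear_combination (f.1 * g.2 - f.2 * g.1 + 1) * h

theorem IsParents.dot_self_lt {f g e : ℤ × ℤ} (h : IsParents f g e) :
    dot f f < dot e e ∧ dot g g < dot e e := by
  have h1 := h.irred.1.dot_self_pos
  have h2 := h.irred.2.1.dot_self_pos
  obtain ⟨-, h3, rfl⟩ := h
  unfold dot at *
  simp only [Prod.fst_add, Prod.snd_add]
  constructor <;> nlinarith

/-- Acuteness of `(f - g, g)` means `‖g‖² ≤ ⟨f, g⟩`. Otherwise `‖f‖²‖g‖² = 1 + ⟨f, g⟩²` would be too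
small, by integrality. -/
theorem IsParents.left_of_lt {f g e : ℤ × ℤ} (h : IsParents f g e) (hlt : dot g g < dot f f) :
    IsParents (f - g) g f := by
  have h0 := h.irred.2.1.dot_self_pos
  obtain ⟨h1, h2, -⟩ := h
  have h3 := dot_self_mul_dot_self h1
  refine ⟨?_, ?_, by abel⟩
  · simp only [Prod.fst_sub, Prod.snd_sub]; linear_combination h1
  · have : dot g g ≤ dot f g := by
      change 0 ≤ dot f g at h2
      by_contra! h4
      nlinarith
    unfold dot at this
    simp only [Prod.fst_sub, Prod.snd_sub]
    linarith

theorem IsParents.right_of_lt {f g e : ℤ × ℤ} (h : IsParents f g e) (hlt : dot f f < dot g g) :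
    IsParents f (g - f) g := by
  have h0 := h.irred.1.dot_self_pos
  obtain ⟨h1, h2, -⟩ := h
  have h3 := dot_self_mul_dot_self h1
  refine ⟨?_, ?_, by abel⟩
  · simp only [Prod.fst_sub, Prod.snd_sub]; linear_combination h1
  · have : dot f f ≤ dot f g := by
      change 0 ≤ dot f g at h2
      by_contra! h4
      nlinarith
    unfold dot at this
    simp only [Prod.fst_sub, Prod.snd_sub]
    linarith

theorem IsParents.dot_self_eq_one {f g e : ℤ × ℤ} (h : IsParents f g e)
    (heq : dot f f = dot g g) : dot f f = 1 := by
  have h0 := h.irred.1.dot_self_pos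
  obtain ⟨h1, h2, -⟩ := h
  have h3 := dot_self_mul_dot_self h1
  rw [← heq] at h3
  change 0 ≤ dot f g at h2
  have h4 : dot f g < dot f f := by by_contra! h4; nlinarith
  nlinarith

/-! ### Nonnegativity of all forms on `Conv(V)` -/

variable {Ω : Set (ℝ × ℝ)} {V : grid Ω → Set (ℤ × ℤ)}

/-- The parallelogram forms outside of the stencils, and the segment forms of all directions, are
nonnegative on `Conv(V)`. -/
theorem par_nonneg_and_seg_nonneg (hconv : Convex ℝ Ω) (hV : IsStencilFamily (grid Ω) V)
    {v : ℤ × ℤ → ℝ} (hv : (fun x : grid Ω => v x) ∈ convStencil (grid Ω) V) (n : ℕ) :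
    ∀ e, dot e e ≤ n → Irred e →
      (∀ x, ∀ hx : x ∈ grid Ω, x + e ∈ grid Ω → e ∉ V ⟨x, hx⟩ → ∀ f g, IsParents f g e →
        0 ≤ v (x + e) - v (x + f) - v (x + g) + v x) ∧
      (∀ x ∈ grid Ω, x + e ∈ grid Ω → x - e ∈ grid Ω →
        0 ≤ v (x + e) - 2 * v x + v (x - e)) := by
  induction n with
  | zero =>
    intro e h he
    have := he.dot_self_pos
    push_cast at h
    omega
  | succ n ih =>
    -- Proved first for all `e` of this norm: the bound on `S_x^e` uses `P_x^e` and `P_x^{-e}` at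
    -- the same norm.
    have hpar : ∀ e, dot e e ≤ (n + 1 : ℕ) → Irred e → ∀ x, ∀ hx : x ∈ grid Ω,
        x + e ∈ grid Ω → e ∉ V ⟨x, hx⟩ → ∀ f g, IsParents f g e →
        0 ≤ v (x + e) - v (x + f) - v (x + g) + v x := by
      intro e hn he x hx hxe heV f g hp
      obtain ⟨⟨hfi, hf⟩, ⟨hgi, hg⟩⟩ := parents_mem_maxStencil hconv hV ⟨x, hx⟩ ⟨he, hxe⟩ heV hp
      have hlt := hp.dot_self_lt
      have hfn : dot f f ≤ n := by push_cast at hn; omega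
      have hgn : dot g g ≤ n := by push_cast at hn; omega
      have cand : f ∈ V ⟨x, hx⟩ → g ∈ V ⟨x, hx⟩ → 0 ≤ v (x + e) - v (x + f) - v (x + g) + v x :=
        fun h1 h2 => (hv ⟨x, hx⟩).2.2 e ⟨⟨he, hxe⟩, heV, f, g, hp, h1, h2⟩ f g hp hxe hf hg
      have hefg : f + g = e := hp.2.2
      rcases lt_trichotomy (dot f f) (dot g g) with h | h | h
      · have hp' := hp.right_of_lt h
        by_cases hgV : g ∈ V ⟨x, hx⟩
        · exact cand ((hV.stability _ g hgV _ _ hp').1 ⟨hfi, hf⟩) hgV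
        -- Here `P_x^e = P_x^g + S_{x+g}^f`, with `f, g` shorter than `e`.
        · have h1 := (ih g hgn hgi).1 x hx hg hgV _ _ hp'
          have hd := (parents_mem_maxStencil hconv hV ⟨x, hx⟩ ⟨hgi, hg⟩ hgV hp').2.2
          have e1 : x + g + f = x + e := by rw [← hefg]; abel
          have e2 : x + g - f = x + (g - f) := by abel
          have h2 := (ih f hfn hfi).2 (x + g) hg (e1 ▸ hxe) (e2 ▸ hd)
          rw [e1, e2] at h2
          linarith
      · refine cand ?_ ?_
        · exact unit_mem_stencil hconv hV _ ⟨hfi, hf⟩ (hp.dot_self_eq_one h)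
        · exact unit_mem_stencil hconv hV _ ⟨hgi, hg⟩ (h ▸ hp.dot_self_eq_one h)
      · have hp' := hp.left_of_lt h
        by_cases hfV : f ∈ V ⟨x, hx⟩
        · exact cand hfV ((hV.stability _ f hfV _ _ hp').2 ⟨hgi, hg⟩)
        · have h1 := (ih f hfn hfi).1 x hx hf hfV _ _ hp'
          have hd := (parents_mem_maxStencil hconv hV ⟨x, hx⟩ ⟨hfi, hf⟩ hfV hp').1.2
          have e1 : x + f + g = x + e := by rw [← hefg]; abel
          have e2 : x + f - g = x + (f - g) := by abel
          have h2 := (ih g hgn hgi).2 (x + f) hf (e1 ▸ hxe) (e2 ▸ hd)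
          rw [e1, e2] at h2
          linarith
    intro e hn he
    refine ⟨hpar e hn he, ?_⟩
    intro x hx hxe hxe'
    have hxn : x + -e ∈ grid Ω := by rwa [← sub_eq_add_neg]
    by_cases heV : e ∈ V ⟨x, hx⟩
    · exact (hv ⟨x, hx⟩).1 e heV hxe hxe'
    by_cases heV' : -e ∈ V ⟨x, hx⟩
    · have h := (hv ⟨x, hx⟩).1 (-e) heV' hxn (by simpa using hxe)
      simp only [segForm, sub_neg_eq_add, ← sub_eq_add_neg] at h
      linarith
    have h1 : dot e e ≠ 1 := fun h1 => heV (unit_mem_stencil hconv hV _ ⟨he, hxe⟩ h1)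
    obtain ⟨f, g, hp⟩ := he.exists_isParents h1
    obtain ⟨⟨hfi, hf⟩, ⟨hgi, hg⟩⟩ := parents_mem_maxStencil hconv hV ⟨x, hx⟩ ⟨he, hxe⟩ heV hp
    obtain ⟨⟨-, hf'⟩, ⟨-, hg'⟩⟩ :=
      parents_mem_maxStencil hconv hV ⟨x, hx⟩ ⟨he.neg, hxn⟩ heV' hp.neg
    have hlt := hp.dot_self_lt
    have hfn : dot f f ≤ n := by push_cast at hn; omega
    have hgn : dot g g ≤ n := by push_cast at hn; omega
    have k1 := hpar e hn he x hx hxe heV f g hp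
    have k2 := hpar (-e) (by simpa [dot] using hn) he.neg x hx hxn heV' _ _ hp.neg
    simp only [← sub_eq_add_neg] at k2 hf' hg'
    have k3 := (ih f hfn hfi).2 x hx hf hf'
    have k4 := (ih g hgn hgi).2 x hx hg hg'
    -- `S_x^e = P_x^e + P_x^{-e} + S_x^f + S_x^g`.
    linarith

theorem seg_nonneg_of_mem_convStencil (hconv : Convex ℝ Ω) (hV : IsStencilFamily (grid Ω) V)
    {v : ℤ × ℤ → ℝ} (hv : (fun x : grid Ω => v x) ∈ convStencil (grid Ω) V) {x e : ℤ × ℤ}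
    (he : Irred e) (hx : x ∈ grid Ω) (h1 : x + e ∈ grid Ω) (h2 : x - e ∈ grid Ω) :
    0 ≤ v (x + e) - 2 * v x + v (x - e) :=
  (par_nonneg_and_seg_nonneg hconv hV hv (dot e e).toNat e (Int.self_le_toNat _) he).2 x hx h1 h2

theorem par_nonneg_of_mem_convStencil (hconv : Convex ℝ Ω) (hV : IsStencilFamily (grid Ω) V)
    {v : ℤ × ℤ → ℝ} (hv : (fun x : grid Ω => v x) ∈ convStencil (grid Ω) V) {x e f g : ℤ × ℤ}
    (hp : IsParents f g e) (hx : x ∈ grid Ω) (h1 : x + e ∈ grid Ω) (h2 : e ∉ V ⟨x, hx⟩) :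
    0 ≤ v (x + e) - v (x + f) - v (x + g) + v x :=
  (par_nonneg_and_seg_nonneg hconv hV hv (dot e e).toNat e (Int.self_le_toNat _) hp.irred.2.2).1
    x hx h1 h2 f g hp

theorem tri_nonneg_of_mem_convStencil (hconv : Convex ℝ Ω) (hV : IsStencilFamily (grid Ω) V)
    {v : ℤ × ℤ → ℝ} (hv : (fun x : grid Ω => v x) ∈ convStencil (grid Ω) V) {x e f g : ℤ × ℤ}
    (hp : IsParents f g e) (hx : x ∈ grid Ω) (h1 : x + e ∈ grid Ω) (h2 : x - f ∈ grid Ω)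
    (h3 : x - g ∈ grid Ω) : 0 ≤ v (x + e) + v (x - f) + v (x - g) - 3 * v x := by
  by_cases heV : e ∈ V ⟨x, hx⟩
  · exact (hv ⟨x, hx⟩).2.1 e heV f g hp h1 h2 h3
  obtain ⟨⟨hfi, hf⟩, ⟨hgi, hg⟩⟩ :=
    parents_mem_maxStencil hconv hV ⟨x, hx⟩ ⟨hp.irred.2.2, h1⟩ heV hp
  have k1 := par_nonneg_of_mem_convStencil hconv hV hv hp hx h1 heV
  have k2 := seg_nonneg_of_mem_convStencil hconv hV hv hfi hx hf h2
  have k3 := seg_nonneg_of_mem_convStencil hconv hV hv hgi hx hg h3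
  linarith

/-! ### Balanced lattice triples in convex sets -/

/-- Three vectors of sum zero that translate `x` into `K`: either `e, -e, 0` with `e` irreducible,
or a direct superbase of `ℤ²`. -/
def HasBalancedTriple (K : Set (ℝ × ℝ)) (x : ℤ × ℤ) : Prop :=
  ∃ h₁ h₂ h₃ : ℤ × ℤ, toPlane (x + h₁) ∈ K ∧ toPlane (x + h₂) ∈ K ∧ toPlane (x + h₃) ∈ K ∧
    h₁ + h₂ + h₃ = 0 ∧ h₁ ≠ 0 ∧ ((Irred h₁ ∧ h₂ = -h₁ ∧ h₃ = 0) ∨ cross h₁ h₂ = 1)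

theorem dot_self_pos_of_ne_zero {p : ℤ × ℤ} (h : p ≠ 0) : 0 < dot p p := by
  by_contra hle
  apply h
  unfold dot at hle
  ext
  · simp only [Prod.fst_zero]; nlinarith [mul_self_nonneg p.1, mul_self_nonneg p.2]
  · simp only [Prod.snd_zero]; nlinarith [mul_self_nonneg p.1, mul_self_nonneg p.2]

/-- The positive relations between plane vectors come from opposite pairs, and from triples that
turn once around the origin. -/
theorem exists_opposite_or_cyclic {A : Finset (ℤ × ℤ)} {w : ℤ × ℤ → ℝ} (hA : A.Nonempty)
    (hA0 : ∀ a ∈ A, a ≠ 0) (hw : ∀ a ∈ A, 0 < w a) (h1 : ∑ a ∈ A, w a * a.1 = 0)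
    (h2 : ∑ a ∈ A, w a * a.2 = 0) :
    (∃ p ∈ A, ∃ q ∈ A, cross p q = 0 ∧ dot p q < 0) ∨
      ∃ p ∈ A, ∃ q ∈ A, ∃ r ∈ A, 0 < cross p q ∧ 0 < cross q r ∧ 0 < cross r p := by
  have key : ∀ m n : ℤ, (∃ a ∈ A, 0 < m * a.1 + n * a.2) → ∃ b ∈ A, m * b.1 + n * b.2 < 0 := by
    rintro m n ⟨a, ha, hpos⟩
    by_contra! hcon
    have hsum : ∑ a ∈ A, w a * ((m * a.1 + n * a.2 : ℤ) : ℝ) = 0 := by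
      have : ∀ a ∈ A, w a * ((m * a.1 + n * a.2 : ℤ) : ℝ) =
          m * (w a * a.1) + n * (w a * a.2) := by
        intro a _; push_cast; ring
      rw [Finset.sum_congr rfl this, Finset.sum_add_distrib, ← Finset.mul_sum, ← Finset.mul_sum,
        h1, h2]
      simp
    have hz := (Finset.sum_eq_zero_iff_of_nonneg (fun b hb =>
      mul_nonneg (hw b hb).le (by exact_mod_cast hcon b hb))).1 hsum a ha
    have : (0 : ℝ) < ((m * a.1 + n * a.2 : ℤ) : ℝ) := by exact_mod_cast hpos
    exact (mul_pos (hw a ha) this).ne' hz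
  obtain ⟨p, hp⟩ := hA
  have hpp := dot_self_pos_of_ne_zero (hA0 p hp)
  by_cases hall : ∀ a ∈ A, cross p a = 0
  · obtain ⟨b, hb, hneg⟩ := key p.1 p.2 ⟨p, hp, hpp⟩
    exact Or.inl ⟨p, hp, b, hb, hall b hb, hneg⟩
  push Not at hall
  obtain ⟨a, ha, hne⟩ := hall
  have hS : (A.filter fun a => 0 < cross p a).Nonempty := by
    rcases lt_or_gt_of_ne hne with h | h
    · obtain ⟨b, hb, hb'⟩ := key p.2 (-p.1) ⟨a, ha, by unfold cross at h; linarith⟩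
      exact ⟨b, Finset.mem_filter.2 ⟨hb, by unfold cross; linarith⟩⟩
    · exact ⟨a, Finset.mem_filter.2 ⟨ha, h⟩⟩
  -- The ratio is the cotangent of the angle from `p` to `a`: `q` is the last vector met when
  -- turning left from `p` through less than a half turn.
  obtain ⟨q, hq, hmin⟩ := Finset.exists_min_image _
    (fun a => (dot p a : ℚ) / (cross p a : ℚ)) hS
  obtain ⟨hqA, hpq⟩ := Finset.mem_filter.1 hq
  obtain ⟨r, hr, hr'⟩ := key q.2 (-q.1) ⟨p, hp, by unfold cross at hpq; linarith⟩
  have hqr : 0 < cross q r := by unfold cross; linarith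
  rcases lt_trichotomy (cross p r) 0 with h | h | h
  · right
    exact ⟨p, hp, q, hqA, r, hr, hpq, hqr, by unfold cross at h ⊢; linarith⟩
  · left
    refine ⟨p, hp, r, hr, h, ?_⟩
    have e : dot p p * cross q r = -(dot p r * cross p q) + cross p r * dot p q := by
      unfold dot cross; ring
    rw [h] at e
    by_contra! hdot
    have := mul_nonneg hdot hpq.le
    have := mul_pos hpp hqr
    linarith
  · exfalso
    have hm := hmin r (Finset.mem_filter.2 ⟨hr, h⟩)
    rw [div_le_div_iff₀ (by exact_mod_cast hpq) (by exact_mod_cast h)] at hm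
    have hm' : dot p q * cross p r ≤ dot p r * cross p q := by exact_mod_cast hm
    have e : dot p p * cross q r = -(dot p r * cross p q) + cross p r * dot p q := by
      unfold dot cross; ring
    have := mul_pos hpp hqr
    linarith

theorem hasBalancedTriple_of_opposite {K : Set (ℝ × ℝ)} (hK : Convex ℝ K) {x p q : ℤ × ℤ}
    (hx : toPlane x ∈ K) (hp : toPlane (x + p) ∈ K) (hq : toPlane (x + q) ∈ K)
    (h0 : cross p q = 0) (hneg : dot p q < 0) : HasBalancedTriple K x := by
  have hp0 : p ≠ 0 := by rintro rfl; simp [dot] at hneg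
  have hg : 0 < Int.gcd p.1 p.2 := by
    refine Nat.pos_of_ne_zero fun h => hp0 ?_
    rw [Int.gcd_eq_zero_iff] at h
    exact Prod.ext h.1 h.2
  obtain ⟨g, e1, e2, hg0, hco, hp1, hp2⟩ := Int.exists_gcd_one' hg
  obtain ⟨m, n, hmn⟩ := Int.isCoprime_iff_gcd_eq_one.2 hco
  have hg0' : (0 : ℤ) < g := by exact_mod_cast hg0
  have hq0 : e1 * q.2 - e2 * q.1 = 0 := by
    have : (g : ℤ) * (e1 * q.2 - e2 * q.1) = 0 := by
      unfold cross at h0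
      rw [hp1, hp2] at h0
      linear_combination h0
    exact (mul_eq_zero.1 this).resolve_left hg0'.ne'
  obtain ⟨k, hk⟩ : ∃ k, k = m * q.1 + n * q.2 := ⟨_, rfl⟩
  have hq1 : q.1 = k * e1 := by rw [hk]; linear_combination -q.1 * hmn - n * hq0
  have hq2 : q.2 = k * e2 := by rw [hk]; linear_combination -q.2 * hmn + m * hq0
  have hkneg : k < 0 := by
    unfold dot at hneg
    rw [hp1, hp2, hq1, hq2] at hneg
    by_contra! hk0
    have : 0 ≤ (g : ℤ) * k * (e1 ^ 2 + e2 ^ 2) := by positivity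
    linarith
  refine ⟨(e1, e2), -(e1, e2), 0, ?_, ?_, by simpa using hx, by simp, ?_, Or.inl ⟨hco, rfl, rfl⟩⟩
  · refine mem_of_convex_comb hK hx hp (by simpa using hx) (s := p) (t := 0) (α := 1) (β := 0) (n := g)
      zero_le_one le_rfl hg0' (by omega) ?_
    ext <;> simp <;> linarith
  · refine mem_of_convex_comb hK hx hq (by simpa using hx) (s := q) (t := 0) (α := 1) (β := 0) (n := -k)
      zero_le_one le_rfl (by omega) (by omega) ?_
    ext <;> simp <;> linarith
  · intro h
    simp only [Prod.mk_eq_zero] at h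
    rw [h.1, h.2] at hmn
    simp at hmn

/-- A lattice triangle `(0, p, q)` of determinant at least two has another lattice point than its
vertices. -/
theorem exists_lattice_point {p q : ℤ × ℤ} (h : 2 ≤ cross p q) :
    ∃ (w : ℤ × ℤ) (α β : ℤ), 0 ≤ α ∧ 0 ≤ β ∧ α < cross p q ∧ β < cross p q ∧
      α + β ≤ cross p q ∧ 0 < α + β ∧ cross p q • w = α • p + β • q := by
  obtain ⟨D, hD⟩ : ∃ D, D = cross p q := ⟨_, rfl⟩
  rw [← hD] at h ⊢
  -- If `D` divided the Cramer coordinates of both unit vectors, the determinant `D` of `(p, q)`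
  -- would divide 1.
  have hv : ∃ v : ℤ × ℤ, ¬ (D ∣ cross v q ∧ D ∣ cross p v) := by
    by_contra! hcon
    obtain ⟨⟨a, ha⟩, ⟨b, hb⟩⟩ := hcon (1, 0)
    obtain ⟨⟨c, hc⟩, ⟨d, hd⟩⟩ := hcon (0, 1)
    simp only [cross] at ha hb hc hd hD
    have : D * (D * (d * a - b * c)) = D * 1 := by
      linear_combination -hD - p.1 * ha - D * a * hd - p.2 * hc + D * c * hb
    have := mul_left_cancel₀ (by omega) this
    have := Int.eq_one_of_dvd_one (by omega) ⟨_, this.symm⟩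
    omega
  obtain ⟨v, hv⟩ := hv
  have ha0 := Int.emod_nonneg (cross v q) (by omega : D ≠ 0)
  have hb0 := Int.emod_nonneg (cross p v) (by omega : D ≠ 0)
  have ha1 := Int.emod_lt_of_pos (cross v q) (by omega : 0 < D)
  have hb1 := Int.emod_lt_of_pos (cross p v) (by omega : 0 < D)
  have ha := Int.emod_add_mul_ediv (cross v q) D
  have hb := Int.emod_add_mul_ediv (cross p v) D
  rw [Int.dvd_iff_emod_eq_zero, Int.dvd_iff_emod_eq_zero] at hv
  generalize cross v q % D = α at *
  generalize cross p v % D = β at *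
  generalize cross v q / D = k at *
  generalize cross p v / D = l at *
  have hrel : D • (v - k • p - l • q) = α • p + β • q := by
    unfold cross at ha hb hD
    ext <;> simp
    · linear_combination -p.1 * ha - q.1 * hb + v.1 * hD
    · linear_combination -p.2 * ha - q.2 * hb + v.2 * hD
  rcases le_or_gt (α + β) D with hle | hlt
  · exact ⟨_, α, β, ha0, hb0, ha1, hb1, hle, by omega, hrel⟩
  -- Beyond the diagonal of the parallelogram, reflect through its center.
  · refine ⟨p + q - (v - k • p - l • q), D - α, D - β, by omega, by omega, by omega, by omega,
      by omega, by omega, ?_⟩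
    rw [smul_sub, hrel]
    module

/-- The sum of determinants is twice the area of the triangle `p, q, r` around the origin. A further
lattice point `w` of the triangle `0, p, q` replaces `p` or `q` according to the side of the line of
`r` it is on, and the area drops; on that line, `w` is opposite to `r`. -/
theorem cyclic_reduction {K : Set (ℝ × ℝ)} (hK : Convex ℝ K) {x p q r : ℤ × ℤ}
    (hx : toPlane x ∈ K) (hp : toPlane (x + p) ∈ K) (hq : toPlane (x + q) ∈ K)
    (hr : toPlane (x + r) ∈ K) (h1 : 2 ≤ cross p q) (h2 : 0 < cross q r) (h3 : 0 < cross r p) :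
    HasBalancedTriple K x ∨ ∃ p' q' r' : ℤ × ℤ, toPlane (x + p') ∈ K ∧ toPlane (x + q') ∈ K ∧
      toPlane (x + r') ∈ K ∧ 0 < cross p' q' ∧ 0 < cross q' r' ∧ 0 < cross r' p' ∧
      cross p' q' + cross q' r' + cross r' p' < cross p q + cross q r + cross r p := by
  obtain ⟨w, α, β, hα, hβ, hαD, hβD, hle, hpos, hw⟩ := exists_lattice_point h1
  have hwK := mem_of_convex_comb hK hx hp hq hα hβ (by omega) hle hw
  have hw1 := congrArg Prod.fst hw
  have hw2 := congrArg Prod.snd hw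
  simp only [Prod.fst_add, Prod.snd_add, Prod.smul_fst, Prod.smul_snd, smul_eq_mul] at hw1 hw2
  have hD : cross p q ≠ 0 := by omega
  have hpw : cross p w = β := by
    apply mul_left_cancel₀ hD
    unfold cross at *
    linear_combination p.1 * hw2 - p.2 * hw1
  have hwq : cross w q = α := by
    apply mul_left_cancel₀ hD
    unfold cross at *
    linear_combination q.2 * hw1 - q.1 * hw2
  have hwr : cross p q * cross w r = β * cross q r - α * cross r p := by
    unfold cross at *
    linear_combination r.2 * hw1 - r.1 * hw2
  rcases lt_trichotomy (cross w r) 0 with h | h | h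
  · right
    have hα0 : 0 < α := by
      by_contra! h0
      obtain rfl : α = 0 := by omega
      nlinarith
    refine ⟨w, q, r, hwK, hq, hr, by omega, h2, by unfold cross at h ⊢; linarith, ?_⟩
    have e : cross r w = -cross w r := by unfold cross; ring
    rw [e, hwq]
    have : 0 < cross p q * (cross p q + cross r p + cross w r - α) := by
      have e2 : cross p q * (cross p q + cross r p + cross w r - α) =
        (cross p q - α) * (cross p q + cross r p) + β * cross q r := by
        linear_combination hwr
      rw [e2]
      have := mul_pos (sub_pos.2 hαD) (by omega : 0 < cross p q + cross r p)
      have := mul_nonneg hβ h2.le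
      linarith
    have := pos_of_mul_pos_right this (by omega)
    linarith
  · left
    refine hasBalancedTriple_of_opposite hK hx hwK hr h ?_
    have hr0 : 0 < dot r r := dot_self_pos_of_ne_zero (by rintro rfl; simp [cross] at h2)
    by_contra! hdot
    have e1 : dot r r * cross p w + dot w r * cross r p = dot p r * cross r w := by
      unfold dot cross; ring
    have e2 : dot r r * cross w q + dot w r * cross q r = dot q r * cross w r := by
      unfold dot cross; ring
    have e3 : cross r w = -cross w r := by unfold cross; ring
    rw [e3, h, hpw] at e1
    rw [h, hwq] at e2
    have := mul_pos hr0 hpos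
    have := mul_nonneg hdot h2.le
    have := mul_nonneg hdot h3.le
    linarith
  · right
    have hβ0 : 0 < β := by
      by_contra! h0
      obtain rfl : β = 0 := by omega
      nlinarith
    refine ⟨p, w, r, hp, hwK, hr, by omega, h, h3, ?_⟩
    rw [hpw]
    have : 0 < cross p q * (cross p q + cross q r - cross w r - β) := by
      have e2 : cross p q * (cross p q + cross q r - cross w r - β) =
        (cross p q - β) * (cross p q + cross q r) + α * cross r p := by
        linear_combination -hwr
      rw [e2]
      have := mul_pos (sub_pos.2 hβD) (by omega : 0 < cross p q + cross q r)
      have := mul_nonneg hα h3.le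
      linarith
    have := pos_of_mul_pos_right this (by omega)
    linarith

theorem hasBalancedTriple_of_cyclic {K : Set (ℝ × ℝ)} (hK : Convex ℝ K) {x : ℤ × ℤ}
    (hx : toPlane x ∈ K) (n : ℕ) {p q r : ℤ × ℤ} (hp : toPlane (x + p) ∈ K)
    (hq : toPlane (x + q) ∈ K) (hr : toPlane (x + r) ∈ K) (h1 : 0 < cross p q)
    (h2 : 0 < cross q r) (h3 : 0 < cross r p)
    (hn : cross p q + cross q r + cross r p ≤ n) : HasBalancedTriple K x := by
  induction n generalizing p q r with
  | zero => push_cast at hn; omega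
  | succ n ih =>
    push_cast at hn
    have step : ∀ {p q r : ℤ × ℤ}, toPlane (x + p) ∈ K → toPlane (x + q) ∈ K →
        toPlane (x + r) ∈ K → 2 ≤ cross p q → 0 < cross q r → 0 < cross r p →
        cross p q + cross q r + cross r p ≤ n + 1 → HasBalancedTriple K x := by
      intro p q r hp hq hr h1 h2 h3 hn
      rcases cyclic_reduction hK hx hp hq hr h1 h2 h3 with
        h | ⟨p', q', r', hp', hq', hr', h1', h2', h3', hlt⟩
      · exact h
      · exact ih hp' hq' hr' h1' h2' h3' (by omega)
    rcases (by omega : 2 ≤ cross p q ∨ 2 ≤ cross q r ∨ 2 ≤ cross r p ∨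
      (cross p q = 1 ∧ cross q r = 1 ∧ cross r p = 1)) with h | h | h | ⟨e1, e2, e3⟩
    · exact step hp hq hr h h2 h3 hn
    · exact step hq hr hp h h3 h1 (by omega)
    · exact step hr hp hq h h1 h2 (by omega)
    · refine ⟨p, q, r, hp, hq, hr, ?_, ?_, Or.inr e1⟩
      -- The identity `cross q r • p + cross r p • q + cross p q • r = 0`, with all determinants
      -- equal to 1.
      · unfold cross at *
        ext <;> simp
        · linear_combination -p.1 * e2 - q.1 * e3 - r.1 * e1
        · linear_combination -p.2 * e2 - q.2 * e3 - r.2 * e1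
      · rintro rfl
        simp [cross] at h1

theorem hasBalancedTriple_of_sum_eq_zero {K : Set (ℝ × ℝ)} (hK : Convex ℝ K) {x : ℤ × ℤ}
    (hx : toPlane x ∈ K) {A : Finset (ℤ × ℤ)} {w : ℤ × ℤ → ℝ} (hA : A.Nonempty)
    (hA0 : ∀ a ∈ A, a ≠ 0) (hAK : ∀ a ∈ A, toPlane (x + a) ∈ K) (hw : ∀ a ∈ A, 0 < w a)
    (h1 : ∑ a ∈ A, w a * a.1 = 0) (h2 : ∑ a ∈ A, w a * a.2 = 0) : HasBalancedTriple K x := by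
  rcases exists_opposite_or_cyclic hA hA0 hw h1 h2 with
    ⟨p, hp, q, hq, h, h'⟩ | ⟨p, hp, q, hq, r, hr, h, h', h''⟩
  · exact hasBalancedTriple_of_opposite hK hx (hAK p hp) (hAK q hq) h h'
  · exact hasBalancedTriple_of_cyclic hK hx _ (hAK p hp) (hAK q hq) (hAK r hr) h h' h''
      (Int.self_le_toNat _)

/-! ### Farkas' lemma and affine minorants -/

/-- **Farkas' lemma** for finitely many linear forms. -/
theorem exists_nonneg_comb_of_forall_nonpos {ι E : Type*} [AddCommGroup E] [Module ℝ E]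
    (s : Finset ι) (a : ι → E →ₗ[ℝ] ℝ) (b : E →ₗ[ℝ] ℝ)
    (h : ∀ v, (∀ i ∈ s, a i v ≤ 0) → b v ≤ 0) :
    ∃ l : ι → ℝ, (∀ i, 0 ≤ l i) ∧ b = ∑ i ∈ s, l i • a i := by
  classical
  induction s using Finset.induction_on generalizing a b with
  | empty =>
    refine ⟨0, fun _ => le_rfl, ?_⟩
    ext v
    have h1 := h v (by simp)
    have h2 := h (-v) (by simp)
    rw [map_neg] at h2
    simp only [Finset.sum_empty, LinearMap.zero_apply]
    linarith
  | insert j s hj ih =>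
    by_cases hb : ∀ v, (∀ i ∈ s, a i v ≤ 0) → b v ≤ 0
    · obtain ⟨l, hl, rfl⟩ := ih a b hb
      refine ⟨fun i => if i = j then 0 else l i, fun i => ?_, ?_⟩
      · dsimp only
        split_ifs
        exacts [le_rfl, hl i]
      · rw [Finset.sum_insert hj]
        dsimp only
        rw [if_pos rfl, zero_smul, zero_add]
        refine Finset.sum_congr rfl fun i hi => ?_
        rw [if_neg (by rintro rfl; exact hj hi)]
    push Not at hb
    obtain ⟨v₀, hv₀, hbv⟩ := hb
    have hjv : 0 < a j v₀ := by
      by_contra! hle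
      exact hbv.not_ge (h v₀ fun i hi => (Finset.mem_insert.1 hi).elim (fun e => e ▸ hle) (hv₀ i))
    -- Project along `v₀` onto the kernel of `a j`: on it the constraint `j` is void, and induction
    -- applies to the projected forms.
    obtain ⟨l, hl, hlb⟩ := ih (fun i => a i - (a i v₀ / a j v₀) • a j)
      (b - (b v₀ / a j v₀) • a j) (by
        intro v hv
        have := h (v - (a j v / a j v₀) • v₀) (by
          intro i hi
          rcases Finset.mem_insert.1 hi with rfl | hi
          · simp only [map_sub, map_smul, smul_eq_mul]
            rw [div_mul_cancel₀ _ hjv.ne', sub_self]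
          · have := hv i hi
            simp only [LinearMap.sub_apply, LinearMap.smul_apply, smul_eq_mul] at this
            simp only [map_sub, map_smul, smul_eq_mul]
            linarith [div_mul_comm (a i v₀) (a j v₀) (a j v)])
        simp only [map_sub, map_smul, smul_eq_mul] at this
        simp only [LinearMap.sub_apply, LinearMap.smul_apply, smul_eq_mul]
        linarith [div_mul_comm (b v₀) (a j v₀) (a j v)])
    refine ⟨fun i => if i = j then (b v₀ - ∑ i ∈ s, l i * a i v₀) / a j v₀ else l i,
      fun i => ?_, ?_⟩
    · dsimp only
      split_ifs
      · refine div_nonneg (sub_nonneg.2 (le_trans (Finset.sum_nonpos fun i hi => ?_) hbv.le)) hjv.le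
        exact mul_nonpos_of_nonneg_of_nonpos (hl i) (hv₀ i hi)
      · exact hl i
    · rw [Finset.sum_insert hj]
      dsimp only
      rw [if_pos rfl]
      have e : ∑ i ∈ s, (if i = j then (b v₀ - ∑ i ∈ s, l i * a i v₀) / a j v₀ else l i) • a i =
          ∑ i ∈ s, l i • a i :=
        Finset.sum_congr rfl fun i hi => by rw [if_neg (by rintro rfl; exact hj hi)]
      rw [e]
      ext v
      have := LinearMap.congr_fun hlb v
      simp only [LinearMap.sub_apply, LinearMap.smul_apply, smul_eq_mul, LinearMap.sum_apply,
        mul_sub, Finset.sum_sub_distrib] at this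
      simp only [LinearMap.add_apply, LinearMap.smul_apply, smul_eq_mul, LinearMap.sum_apply]
      have e2 : ∑ i ∈ s, l i * (a i v₀ / a j v₀ * a j v) =
          (∑ i ∈ s, l i * a i v₀) / a j v₀ * a j v := by
        rw [Finset.sum_div, Finset.sum_mul]
        exact Finset.sum_congr rfl fun i _ => by ring
      rw [e2] at this
      rw [sub_div, sub_mul]
      linarith

/-- A function on a finite set of points of the plane, that is at the point `x` below its averages
of barycenter `x`, has an affine minorant that is exact at `x`. -/
theorem exists_affine_minorant {ι : Type*} [Fintype ι] (p : ι → ℝ × ℝ) (c : ι → ℝ) (x : ι)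
    (h : ∀ w ∈ stdSimplex ℝ ι, ∑ i, w i • p i = p x → c x ≤ ∑ i, w i * c i) :
    ∃ α β : ℝ, ∀ i, c x + α * ((p i).1 - (p x).1) + β * ((p i).2 - (p x).2) ≤ c i := by
  let a : ι → (ℝ × ℝ × ℝ) →ₗ[ℝ] ℝ := fun i =>
    ((p i).1 - (p x).1) • LinearMap.fst ℝ ℝ (ℝ × ℝ) +
      ((p i).2 - (p x).2) • (LinearMap.fst ℝ ℝ ℝ ∘ₗ LinearMap.snd ℝ ℝ (ℝ × ℝ)) -
      (c i - c x) • (LinearMap.snd ℝ ℝ ℝ ∘ₗ LinearMap.snd ℝ ℝ (ℝ × ℝ))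
  have ha : ∀ i ξ η τ, a i (ξ, η, τ) =
      ((p i).1 - (p x).1) * ξ + ((p i).2 - (p x).2) * η - (c i - c x) * τ := by
    intro i ξ η τ
    simp [a]
  by_cases hex : ∃ ξ η τ : ℝ, 0 < τ ∧ ∀ i, a i (ξ, η, τ) ≤ 0
  · obtain ⟨ξ, η, τ, hτ, hle⟩ := hex
    refine ⟨ξ / τ, η / τ, fun i => ?_⟩
    have := hle i
    rw [ha] at this
    have e : c x + ξ / τ * ((p i).1 - (p x).1) + η / τ * ((p i).2 - (p x).2) - c i =
        (((p i).1 - (p x).1) * ξ + ((p i).2 - (p x).2) * η - (c i - c x) * τ) / τ := by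
      field_simp
      ring
    have := div_nonpos_of_nonpos_of_nonneg this hτ.le
    linarith
  · exfalso
    push Not at hex
    -- The constraints imply `τ ≤ 0`, so `τ` is a nonnegative combination of them. Normalized, its
    -- weights have barycenter `p x` and average strictly below `c x`.
    obtain ⟨l, hl, hlb⟩ := exists_nonneg_comb_of_forall_nonpos Finset.univ a
      (LinearMap.snd ℝ ℝ ℝ ∘ₗ LinearMap.snd ℝ ℝ (ℝ × ℝ)) (by
        rintro ⟨ξ, η, τ⟩ hv
        by_contra! hτ
        obtain ⟨i, hi⟩ := hex ξ η τ hτ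
        exact hi.not_ge (hv i (Finset.mem_univ i)))
    have hξ := LinearMap.congr_fun hlb (1, 0, 0)
    have hη := LinearMap.congr_fun hlb (0, 1, 0)
    have hτ := LinearMap.congr_fun hlb (0, 0, 1)
    simp only [LinearMap.sum_apply, LinearMap.smul_apply, ha, smul_eq_mul, LinearMap.comp_apply,
      LinearMap.snd_apply, mul_one, mul_zero, add_zero, sub_zero, zero_add, zero_sub, mul_neg,
      mul_sub, Finset.sum_sub_distrib, Finset.sum_neg_distrib, ← Finset.sum_mul] at hξ hη hτ
    set L := ∑ i, l i with hL
    have hLpos : 0 < L := by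
      refine (Finset.sum_nonneg fun i _ => hl i).lt_of_ne fun h0 => ?_
      have hz := (Finset.sum_eq_zero_iff_of_nonneg (fun i _ => hl i)).1 h0.symm
      have : ∑ i, l i * c i = 0 :=
        Finset.sum_eq_zero fun i hi => by rw [hz i hi, zero_mul]
      rw [this, hL, ← h0] at hτ
      norm_num at hτ
    have := h (fun i => l i / L) ⟨fun i => div_nonneg (hl i) hLpos.le, by
      rw [← Finset.sum_div, div_self hLpos.ne']⟩ (by
        ext
        · simp only [Prod.fst_sum, Prod.smul_fst, smul_eq_mul, div_mul_eq_mul_div]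
          rw [← Finset.sum_div, div_eq_iff hLpos.ne']
          linarith
        · simp only [Prod.snd_sum, Prod.smul_snd, smul_eq_mul, div_mul_eq_mul_div]
          rw [← Finset.sum_div, div_eq_iff hLpos.ne']
          linarith)
    simp only [div_mul_eq_mul_div] at this
    rw [← Finset.sum_div, le_div_iff₀ hLpos] at this
    linarith

/-! ### Superbases and triangle forms -/

theorem isParents_of_superbase {h₁ h₂ h₃ : ℤ × ℤ} (hsum : h₁ + h₂ + h₃ = 0)
    (hdet : cross h₁ h₂ = 1) (hdot : 0 ≤ dot h₁ h₂) : IsParents (-h₁) (-h₂) h₃ := by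
  refine ⟨?_, ?_, ?_⟩
  · simpa [cross] using hdet
  · simpa [dot] using hdot
  · rw [← neg_add, neg_eq_iff_add_eq_zero]
    exact hsum

/-- A superbase of `ℤ²` is not strictly obtuse. -/
theorem exists_dot_nonneg_of_superbase {h₁ h₂ h₃ : ℤ × ℤ} (hsum : h₁ + h₂ + h₃ = 0)
    (hdet : cross h₁ h₂ = 1) : 0 ≤ dot h₁ h₂ ∨ 0 ≤ dot h₂ h₃ ∨ 0 ≤ dot h₃ h₁ := by
  obtain rfl : h₃ = -(h₁ + h₂) := (neg_eq_of_add_eq_zero_right hsum).symm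
  by_contra! h
  obtain ⟨a1, a2, a3⟩ := h
  have e : dot h₁ h₁ * dot h₂ h₂ = 1 + dot h₁ h₂ ^ 2 := dot_self_mul_dot_self hdet
  have e1 : dot h₂ (-(h₁ + h₂)) = -dot h₁ h₂ - dot h₂ h₂ := by
    simp only [dot, Prod.fst_neg, Prod.snd_neg, Prod.fst_add, Prod.snd_add]; ring
  have e2 : dot (-(h₁ + h₂)) h₁ = -dot h₁ h₂ - dot h₁ h₁ := by
    simp only [dot, Prod.fst_neg, Prod.snd_neg, Prod.fst_add, Prod.snd_add]; ring
  rw [e1] at a2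
  rw [e2] at a3
  -- With `d = ⟨h₁, h₂⟩ < 0`, integrality gives `‖h₁‖², ‖h₂‖² ≥ 1 - d`, hence a product of at least
  -- `(1 - d)² > 1 + d²`.
  nlinarith [mul_pos (by linarith : 0 < dot h₂ h₂ + dot h₁ h₂)
    (by linarith : 0 < dot h₁ h₁ + dot h₁ h₂)]

/-- Segment and triangle forms control the averages over balanced triples. -/
theorem three_mul_le_of_balanced {X : Set (ℤ × ℤ)} {v : ℤ × ℤ → ℝ}
    (hS : ∀ x e, Irred e → x ∈ X → x + e ∈ X → x - e ∈ X → 0 ≤ v (x + e) - 2 * v x + v (x - e))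
    (hT : ∀ x e f g, IsParents f g e → x ∈ X → x + e ∈ X → x - f ∈ X → x - g ∈ X →
      0 ≤ v (x + e) + v (x - f) + v (x - g) - 3 * v x)
    {x h₁ h₂ h₃ : ℤ × ℤ} (hx : x ∈ X) (hx₁ : x + h₁ ∈ X) (hx₂ : x + h₂ ∈ X) (hx₃ : x + h₃ ∈ X)
    (hsum : h₁ + h₂ + h₃ = 0)
    (h : (Irred h₁ ∧ h₂ = -h₁ ∧ h₃ = 0) ∨ cross h₁ h₂ = 1) :
    3 * v x ≤ v (x + h₁) + v (x + h₂) + v (x + h₃) := by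
  rcases h with ⟨hirr, rfl, rfl⟩ | h
  · rw [← sub_eq_add_neg] at hx₂ ⊢
    have := hS x h₁ hirr hx hx₁ hx₂
    rw [add_zero]
    linarith
  have key : ∀ {h₁ h₂ h₃ : ℤ × ℤ}, x + h₁ ∈ X → x + h₂ ∈ X → x + h₃ ∈ X → h₁ + h₂ + h₃ = 0 →
      cross h₁ h₂ = 1 → 0 ≤ dot h₁ h₂ → 3 * v x ≤ v (x + h₁) + v (x + h₂) + v (x + h₃) := by
    intro h₁ h₂ h₃ hx₁ hx₂ hx₃ hsum hdet hdot
    have := hT x h₃ _ _ (isParents_of_superbase hsum hdet hdot) hx hx₃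
      (by rwa [sub_neg_eq_add]) (by rwa [sub_neg_eq_add])
    rw [sub_neg_eq_add, sub_neg_eq_add] at this
    linarith
  obtain rfl : h₃ = -(h₁ + h₂) := (neg_eq_of_add_eq_zero_right hsum).symm
  have h' : cross h₂ (-(h₁ + h₂)) = 1 := by
    rw [← h]; simp only [cross, Prod.fst_neg, Prod.snd_neg, Prod.fst_add, Prod.snd_add]; ring
  have h'' : cross (-(h₁ + h₂)) h₁ = 1 := by
    rw [← h]; simp only [cross, Prod.fst_neg, Prod.snd_neg, Prod.fst_add, Prod.snd_add]; ring
  rcases exists_dot_nonneg_of_superbase hsum h with hd | hd | hd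
  · exact key hx₁ hx₂ hx₃ hsum h hd
  · have := key hx₂ hx₃ hx₁ (by abel) h' hd
    linarith
  · have := key hx₃ hx₁ hx₂ (by abel) h'' hd
    linarith

/-! ### The lower convex envelope on the grid -/

/-- Averages of minimal value over all those with a given barycenter are also maximal among those
that are carried by the same points. -/
theorem sum_le_of_support_subset {ι : Type*} [Fintype ι] {p : ι → ℝ × ℝ} {c : ι → ℝ}
    {w z : ι → ℝ} (hw : w ∈ stdSimplex ℝ ι) (hz : z ∈ stdSimplex ℝ ι)
    (hzw : ∑ i, z i • p i = ∑ i, w i • p i) (hsupp : ∀ i, z i ≠ 0 → w i ≠ 0)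
    (hmin : ∀ w' ∈ stdSimplex ℝ ι, ∑ i, w' i • p i = ∑ i, w i • p i →
      ∑ i, w i * c i ≤ ∑ i, w' i * c i) :
    ∑ i, z i * c i ≤ ∑ i, w i * c i := by
  classical
  have hle1 : ∀ {z : ι → ℝ}, z ∈ stdSimplex ℝ ι → ∀ i, z i ≤ 1 := fun {z} hz i =>
    hz.2 ▸ Finset.single_le_sum (fun j _ => hz.1 j) (Finset.mem_univ i)
  have hne : (Finset.univ.filter fun i => w i ≠ 0).Nonempty := by
    by_contra h
    rw [Finset.not_nonempty_iff_eq_empty, Finset.filter_eq_empty_iff] at h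
    have : ∑ i, w i = 0 := Finset.sum_eq_zero fun i hi => not_not.1 (h hi)
    rw [hw.2] at this
    exact one_ne_zero this
  obtain ⟨m, hm, hmle⟩ := Finset.exists_min_image _ w hne
  have hm0 : 0 < w m := (hw.1 m).lt_of_ne' (Finset.mem_filter.1 hm).2
  -- With half the least positive weight, `w - t z` stays nonnegative and `1 - t > 0`; minimality
  -- against `(w - t z) / (1 - t)` gives the bound.
  obtain ⟨t, ht⟩ : ∃ t, t = w m / 2 := ⟨_, rfl⟩
  have ht0 : 0 < t := by linarith
  have ht1 : 0 < 1 - t := by linarith [hle1 hw m]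
  have hsub : ∀ i, 0 ≤ w i - t * z i := by
    intro i
    by_cases hi : z i = 0
    · simpa [hi] using hw.1 i
    · have h1 := hmle i (Finset.mem_filter.2 ⟨Finset.mem_univ i, hsupp i hi⟩)
      have h2 := mul_le_mul_of_nonneg_left (hle1 hz i) ht0.le
      linarith
  have := hmin (fun i => (1 - t)⁻¹ * (w i - t * z i))
    ⟨fun i => mul_nonneg (inv_nonneg.2 ht1.le) (hsub i), by
      rw [← Finset.mul_sum, Finset.sum_sub_distrib, ← Finset.mul_sum, hw.2, hz.2, mul_one,
        inv_mul_cancel₀ ht1.ne']⟩ (by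
      simp only [mul_smul, sub_smul]
      rw [← Finset.smul_sum, Finset.sum_sub_distrib, ← Finset.smul_sum, hzw,
        inv_smul_eq_iff₀ ht1.ne', sub_smul, one_smul])
  simp only [mul_assoc, sub_mul] at this
  rw [← Finset.mul_sum, Finset.sum_sub_distrib, ← Finset.mul_sum, ← div_eq_inv_mul,
    le_div_iff₀ ht1] at this
  nlinarith

theorem finite_grid (hcomp : IsCompact Ω) : (grid Ω).Finite := by
  obtain ⟨R, hR⟩ := hcomp.isBounded.subset_closedBall 0
  refine (Set.finite_Icc ((-⌈R⌉, -⌈R⌉) : ℤ × ℤ) (⌈R⌉, ⌈R⌉)).subset fun z hz => ?_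
  have h := hR hz
  rw [mem_closedBall_zero_iff] at h
  have h1 := abs_le.1 ((norm_fst_le _).trans h : ‖(toPlane z).1‖ ≤ R)
  have h2 := abs_le.1 ((norm_snd_le _).trans h : ‖(toPlane z).2‖ ≤ R)
  simp only [toPlane] at h1 h2
  have hc := Int.le_ceil R
  refine ⟨⟨?_, ?_⟩, ⟨?_, ?_⟩⟩ <;> refine Int.cast_le (R := ℝ) |>.1 ?_ <;> push_cast <;> linarith

/-- A function on the grid with nonnegative segment and triangle forms is below its averages. -/
theorem le_average_of_forms_nonneg (hconv : Convex ℝ Ω) [Fintype (grid Ω)] {v : ℤ × ℤ → ℝ}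
    (hS : ∀ x e, Irred e → x ∈ grid Ω → x + e ∈ grid Ω → x - e ∈ grid Ω →
      0 ≤ v (x + e) - 2 * v x + v (x - e))
    (hT : ∀ x e f g, IsParents f g e → x ∈ grid Ω → x + e ∈ grid Ω → x - f ∈ grid Ω →
      x - g ∈ grid Ω → 0 ≤ v (x + e) + v (x - f) + v (x - g) - 3 * v x)
    (x : grid Ω) (w : grid Ω → ℝ) (hw : w ∈ stdSimplex ℝ (grid Ω))
    (hwx : ∑ i : grid Ω, w i • toPlane i = toPlane x) : v x ≤ ∑ i : grid Ω, w i * v i := by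
  classical
  have hsingle : ∀ x : grid Ω, Pi.single x 1 ∈ stdSimplex ℝ (grid Ω) ∧
      ∑ i : grid Ω, (Pi.single x 1 : grid Ω → ℝ) i • toPlane i = toPlane x ∧
      ∑ i : grid Ω, (Pi.single x 1 : grid Ω → ℝ) i * v i = v x := by
    intro x
    refine ⟨single_mem_stdSimplex ℝ x, ?_, ?_⟩ <;> simp [Pi.single_apply]
  have hmin : ∀ x : grid Ω, ∃ w ∈ stdSimplex ℝ (grid Ω), ∑ i, w i • toPlane i = toPlane x ∧
      ∀ w' ∈ stdSimplex ℝ (grid Ω), ∑ i : grid Ω, w' i • toPlane i = toPlane x →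
        ∑ i : grid Ω, w i * v i ≤ ∑ i : grid Ω, w' i * v i := by
    intro x
    have hc : IsCompact (stdSimplex ℝ (grid Ω) ∩
        {w | ∑ i : grid Ω, w i • toPlane i = toPlane x}) :=
      (isCompact_stdSimplex ℝ _).inter_right (isClosed_eq (by fun_prop) (by fun_prop))
    obtain ⟨w, hw, hle⟩ := hc.exists_isMinOn ⟨_, (hsingle x).1, (hsingle x).2.1⟩
      (f := fun w => ∑ i : grid Ω, w i * v i) (by fun_prop)
    exact ⟨w, hw.1, hw.2, fun w' h1 h2 => hle ⟨h1, h2⟩⟩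
  choose W hWs hWx hWmin using hmin
  obtain ⟨gap, hgap⟩ : ∃ gap : grid Ω → ℝ, ∀ y, gap y = v y - ∑ i, W y i * v i := ⟨_, fun _ => rfl⟩
  suffices hall : ∀ y, gap y ≤ 0 by
    have h1 := hall x
    have h2 := hWmin x w hw hwx
    rw [hgap] at h1
    linarith
  by_contra! hpos
  obtain ⟨y₀, hy₀⟩ := hpos
  obtain ⟨y₁, -, hy₁⟩ := Finset.exists_max_image Finset.univ gap ⟨y₀, Finset.mem_univ _⟩
  obtain ⟨x, hx, hxmax⟩ := Finset.exists_max_image (Finset.univ.filter fun y => gap y = gap y₁)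
    (fun y => dot y y) ⟨y₁, by simp⟩
  have hxg : gap x = gap y₁ := (Finset.mem_filter.1 hx).2
  have hgle : ∀ y, gap y ≤ gap x := fun y => hxg ▸ hy₁ y (Finset.mem_univ _)
  have hdle : ∀ y, gap y = gap x → dot y y ≤ dot x x := fun y hy =>
    hxmax y (Finset.mem_filter.2 ⟨Finset.mem_univ _, hy.trans hxg⟩)
  have hgx : 0 < gap x := hy₀.trans_le (hgle y₀)
  clear hxmax hxg hy₁ hx y₁ hy₀ y₀ hwx hw w
  have hface : ∀ z ∈ stdSimplex ℝ (grid Ω), ∑ i : grid Ω, z i • toPlane i = toPlane x →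
      (∀ i, z i ≠ 0 → W x i ≠ 0) → ∑ i : grid Ω, z i * v i ≤ ∑ i : grid Ω, W x i * v i := by
    intro z hz hzx hsupp
    refine sum_le_of_support_subset (p := fun i : grid Ω => toPlane i) (hWs x) hz
      (hzx.trans (hWx x).symm) hsupp fun w' h1 h2 => hWmin x w' h1 (h2.trans (hWx x))
  -- If `x` carried weight, the point mass at `x` would be an admissible average, forcing `gap x ≤
  -- 0`.
  have hWxx : W x x = 0 := by
    by_contra hne
    have := hface _ (hsingle x).1 (hsingle x).2.1 fun i hi => by
      rw [Pi.single_apply] at hi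
      have : i = x := by by_contra h; exact hi (if_neg h)
      rwa [this]
    rw [(hsingle x).2.2] at this
    have := hgap x
    linarith
  let K : Set (ℝ × ℝ) := {y | ∃ z ∈ stdSimplex ℝ (grid Ω), (∀ i, z i ≠ 0 → W x i ≠ 0) ∧
    ∑ i : grid Ω, z i • toPlane i = y}
  have hK : Convex ℝ K := by
    rintro _ ⟨z₁, hz₁, hs₁, rfl⟩ _ ⟨z₂, hz₂, hs₂, rfl⟩ a b ha hb hab
    refine ⟨a • z₁ + b • z₂, convex_stdSimplex ℝ _ hz₁ hz₂ ha hb hab, fun i hi h0 => hi ?_, ?_⟩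
    · have h1 : z₁ i = 0 := by by_contra h; exact hs₁ i h h0
      have h2 : z₂ i = 0 := by by_contra h; exact hs₂ i h h0
      simp [h1, h2]
    · simp only [Pi.add_apply, Pi.smul_apply, add_smul, smul_assoc, Finset.sum_add_distrib,
        Finset.smul_sum]
  have hKΩ : K ⊆ Ω := by
    rintro _ ⟨z, hz, -, rfl⟩
    exact hconv.sum_mem (fun i _ => hz.1 i) hz.2 fun i _ => i.2
  have hxK : toPlane x ∈ K := ⟨W x, hWs x, fun _ h => h, hWx x⟩
  have hiK : ∀ i : grid Ω, W x i ≠ 0 → toPlane i ∈ K := fun i hi =>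
    ⟨_, (hsingle i).1, fun j hj => by
      rw [Pi.single_apply] at hj
      have : j = i := by by_contra h; exact hj (if_neg h)
      rwa [this], (hsingle i).2.1⟩
  have hbal : HasBalancedTriple K x := by
    have hsum : ∀ φ : ℤ × ℤ → ℝ,
        ∑ a ∈ (Finset.univ.filter fun i => W x i ≠ 0).image (fun i : grid Ω => (i : ℤ × ℤ) - x),
          (if h : (x : ℤ × ℤ) + a ∈ grid Ω then W x ⟨x + a, h⟩ else 0) * φ a =
        ∑ i : grid Ω, W x i * φ (i - x) := by
      intro φ
      rw [Finset.sum_image (fun i _ j _ h => Subtype.ext (sub_left_injective h))]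
      rw [Finset.sum_filter]
      refine Finset.sum_congr rfl fun i _ => ?_
      by_cases h0 : W x i = 0
      · simp [h0]
      · rw [if_pos h0]
        simp
    refine hasBalancedTriple_of_sum_eq_zero hK hxK
      (A := (Finset.univ.filter fun i => W x i ≠ 0).image (fun i : grid Ω => (i : ℤ × ℤ) - x))
      -- The default 0 is never taken on `A`, whose members are differences `i - x` with `i` in the
      -- grid.
      (w := fun a => if h : (x : ℤ × ℤ) + a ∈ grid Ω then W x ⟨x + a, h⟩ else 0)
      ?_ ?_ ?_ ?_ ?_ ?_
    · rw [Finset.image_nonempty]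
      by_contra h
      rw [Finset.not_nonempty_iff_eq_empty, Finset.filter_eq_empty_iff] at h
      have : ∑ i, W x i = 0 := Finset.sum_eq_zero fun i hi => not_not.1 (h hi)
      rw [(hWs x).2] at this
      exact one_ne_zero this
    · simp only [Finset.mem_image, Finset.mem_filter, Finset.mem_univ, true_and]
      rintro _ ⟨i, hi, rfl⟩ h0
      rw [Subtype.ext (sub_eq_zero.1 h0)] at hi
      exact hi hWxx
    · simp only [Finset.mem_image, Finset.mem_filter, Finset.mem_univ, true_and]
      rintro _ ⟨i, hi, rfl⟩
      rw [add_sub_cancel]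
      exact hiK i hi
    · simp only [Finset.mem_image, Finset.mem_filter, Finset.mem_univ, true_and]
      rintro _ ⟨i, hi, rfl⟩
      simp only [add_sub_cancel, Subtype.coe_prop, dite_true, Subtype.coe_eta]
      exact ((hWs x).1 i).lt_of_ne' hi
    · rw [hsum fun a => (a.1 : ℝ)]
      have := congrArg Prod.fst (hWx x)
      simp only [Prod.fst_sum, Prod.smul_fst, smul_eq_mul, toPlane] at this
      simp only [Prod.fst_sub, Int.cast_sub, mul_sub, Finset.sum_sub_distrib, ← Finset.sum_mul]
      rw [this, (hWs x).2]
      ring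
    · rw [hsum fun a => (a.2 : ℝ)]
      have := congrArg Prod.snd (hWx x)
      simp only [Prod.snd_sum, Prod.smul_snd, smul_eq_mul, toPlane] at this
      simp only [Prod.snd_sub, Int.cast_sub, mul_sub, Finset.sum_sub_distrib, ← Finset.sum_mul]
      rw [this, (hWs x).2]
      ring
  obtain ⟨h₁, h₂, h₃, hK₁, hK₂, hK₃, hsum, hne, hcase⟩ := hbal
  have hthree := three_mul_le_of_balanced hS hT x.2 (hKΩ hK₁) (hKΩ hK₂) (hKΩ hK₃) hsum hcase
  obtain ⟨y₁, hy₁⟩ : ∃ y : grid Ω, (y : ℤ × ℤ) = x + h₁ := ⟨⟨_, hKΩ hK₁⟩, rfl⟩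
  obtain ⟨y₂, hy₂⟩ : ∃ y : grid Ω, (y : ℤ × ℤ) = x + h₂ := ⟨⟨_, hKΩ hK₂⟩, rfl⟩
  obtain ⟨y₃, hy₃⟩ : ∃ y : grid Ω, (y : ℤ × ℤ) = x + h₃ := ⟨⟨_, hKΩ hK₃⟩, rfl⟩
  have hs1 : h₁.1 + h₂.1 + h₃.1 = 0 := congrArg Prod.fst hsum
  have hs2 : h₁.2 + h₂.2 + h₃.2 = 0 := congrArg Prod.snd hsum
  obtain ⟨z₁, hz₁, hz₁s, hz₁x⟩ := hK₁
  obtain ⟨z₂, hz₂, hz₂s, hz₂x⟩ := hK₂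
  obtain ⟨z₃, hz₃, hz₃s, hz₃x⟩ := hK₃
  -- The mean of the averages for the three points has barycenter `x` and is carried by the support
  -- of `W x`.
  have hz : ∑ i : grid Ω, (fun i => (z₁ i + z₂ i + z₃ i) / 3) i * v i ≤
      ∑ i : grid Ω, W x i * v i := by
    refine hface _ ⟨fun i => ?_, ?_⟩ ?_ fun i hi h0 => hi ?_
    · have := hz₁.1 i
      have := hz₂.1 i
      have := hz₃.1 i
      positivity
    · rw [← Finset.sum_div, Finset.sum_add_distrib, Finset.sum_add_distrib, hz₁.2, hz₂.2, hz₃.2]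
      norm_num
    · simp only [div_eq_inv_mul, mul_smul, add_smul]
      rw [← Finset.smul_sum, Finset.sum_add_distrib, Finset.sum_add_distrib, hz₁x, hz₂x, hz₃x]
      have hs1' : (h₁.1 : ℝ) + h₂.1 + h₃.1 = 0 := by exact_mod_cast hs1
      have hs2' : (h₁.2 : ℝ) + h₂.2 + h₃.2 = 0 := by exact_mod_cast hs2
      ext
      · simp [toPlane]; linarith
      · simp [toPlane]; linarith
    · have e1 : z₁ i = 0 := by by_contra h; exact hz₁s i h h0
      have e2 : z₂ i = 0 := by by_contra h; exact hz₂s i h h0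
      have e3 : z₃ i = 0 := by by_contra h; exact hz₃s i h h0
      simp [e1, e2, e3]
  simp only [div_mul_eq_mul_div, add_mul] at hz
  rw [← Finset.sum_div, Finset.sum_add_distrib, Finset.sum_add_distrib] at hz
  have hm1 := hWmin y₁ z₁ hz₁ (by rw [hz₁x, hy₁])
  have hm2 := hWmin y₂ z₂ hz₂ (by rw [hz₂x, hy₂])
  have hm3 := hWmin y₃ z₃ hz₃ (by rw [hz₃x, hy₃])
  rw [← hy₁, ← hy₂, ← hy₃] at hthree
  have hg1 := hgle y₁
  have hg2 := hgle y₂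
  have hg3 := hgle y₃
  have hx0 := hgap x
  have hg1' := hgap y₁
  have hg2' := hgap y₂
  have hg3' := hgap y₃
  -- The bounds add up to `3 gap x ≤ gap y₁ + gap y₂ + gap y₃`, so the three gaps equal the maximum.
  have hd1 := hdle y₁ (by linarith)
  have hd2 := hdle y₂ (by linarith)
  have hd3 := hdle y₃ (by linarith)
  rw [hy₁] at hd1
  rw [hy₂] at hd2
  rw [hy₃] at hd3
  have hpos := dot_self_pos_of_ne_zero hne
  simp only [dot, Prod.fst_add, Prod.snd_add] at hd1 hd2 hd3 hpos
  have e3 : h₃.1 = -h₁.1 - h₂.1 := by linarith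
  have e4 : h₃.2 = -h₁.2 - h₂.2 := by linarith
  nlinarith [mul_self_nonneg h₂.1, mul_self_nonneg h₂.2, mul_self_nonneg h₃.1,
    mul_self_nonneg h₃.2, congrArg (fun t => (x : ℤ × ℤ).1 * t) hs1,
    congrArg (fun t => (x : ℤ × ℤ).2 * t) hs2]

theorem mem_convGrid_of_forms_nonneg (hconv : Convex ℝ Ω) (hcomp : IsCompact Ω)
    {v : ℤ × ℤ → ℝ}
    (hS : ∀ x e, Irred e → x ∈ grid Ω → x + e ∈ grid Ω → x - e ∈ grid Ω →
      0 ≤ v (x + e) - 2 * v x + v (x - e))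
    (hT : ∀ x e f g, IsParents f g e → x ∈ grid Ω → x + e ∈ grid Ω → x - f ∈ grid Ω →
      x - g ∈ grid Ω → 0 ≤ v (x + e) + v (x - f) + v (x - g) - 3 * v x) :
    (fun x : grid Ω => v x) ∈ convGrid Ω := by
  have := (finite_grid hcomp).fintype
  choose α β hαβ using fun x => exists_affine_minorant (fun i : grid Ω => toPlane i)
    (fun i : grid Ω => v i) x (le_average_of_forms_nonneg hconv hS hT x)
  rcases isEmpty_or_nonempty (grid Ω) with hemp | hne
  · exact ⟨0, convexOn_const 0 hconv, fun x => hemp.elim x⟩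
  have hun : (Finset.univ : Finset (grid Ω)).Nonempty := Finset.univ_nonempty
  refine ⟨fun y => Finset.univ.sup' hun fun x : grid Ω =>
    v x + α x * (y.1 - (toPlane x).1) + β x * (y.2 - (toPlane x).2), ⟨hconv, ?_⟩, fun x => ?_⟩
  · intro y _ z _ a b ha hb hab
    refine Finset.sup'_le _ _ fun x _ => ?_
    have h1 := mul_le_mul_of_nonneg_left (Finset.le_sup' (fun x : grid Ω =>
      v x + α x * (y.1 - (toPlane x).1) + β x * (y.2 - (toPlane x).2)) (Finset.mem_univ x)) ha
    have h2 := mul_le_mul_of_nonneg_left (Finset.le_sup' (fun x : grid Ω =>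
      v x + α x * (z.1 - (toPlane x).1) + β x * (z.2 - (toPlane x).2)) (Finset.mem_univ x)) hb
    refine le_trans (le_of_eq ?_) (add_le_add h1 h2)
    simp only [Prod.fst_add, Prod.snd_add, Prod.smul_fst, Prod.smul_snd, smul_eq_mul]
    obtain rfl : a = 1 - b := by linarith
    ring
  · refine le_antisymm ?_ (Finset.sup'_le _ _ fun i _ => hαβ i x)
    refine le_trans (le_of_eq ?_) (Finset.le_sup' (fun i : grid Ω =>
      v i + α i * ((toPlane x).1 - (toPlane i).1) + β i * ((toPlane x).2 - (toPlane i).2))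
      (Finset.mem_univ x))
    ring

/-! ### Forms of convex functions, and the conclusion -/

theorem seg_nonneg_of_convexOn {U : ℝ × ℝ → ℝ} (hU : ConvexOn ℝ Ω U) {x e : ℤ × ℤ}
    (h1 : x + e ∈ grid Ω) (h2 : x - e ∈ grid Ω) :
    0 ≤ U (toPlane (x + e)) - 2 * U (toPlane x) + U (toPlane (x - e)) := by
  have h := hU.2 h1 h2 (by norm_num : (0 : ℝ) ≤ 1 / 2) (by norm_num : (0 : ℝ) ≤ 1 / 2)
    (by norm_num)
  have e1 : (1 / 2 : ℝ) • toPlane (x + e) + (1 / 2 : ℝ) • toPlane (x - e) = toPlane x := by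
    ext <;> simp [toPlane] <;> ring
  rw [e1, smul_eq_mul, smul_eq_mul] at h
  linarith

theorem tri_nonneg_of_convexOn {U : ℝ × ℝ → ℝ} (hU : ConvexOn ℝ Ω U) {x e f g : ℤ × ℤ}
    (he : f + g = e) (h1 : x + e ∈ grid Ω) (h2 : x - f ∈ grid Ω) (h3 : x - g ∈ grid Ω) :
    0 ≤ U (toPlane (x + e)) + U (toPlane (x - f)) + U (toPlane (x - g)) - 3 * U (toPlane x) := by
  subst he
  have h := hU.map_sum_le (t := (Finset.univ : Finset (Fin 3))) (w := fun _ => 1 / 3)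
    (p := ![toPlane (x + (f + g)), toPlane (x - f), toPlane (x - g)])
    (fun _ _ => by norm_num) (by simp) (by intro i _; fin_cases i <;> assumption)
  have e1 : ∑ i : Fin 3, (1 / 3 : ℝ) •
      (![toPlane (x + (f + g)), toPlane (x - f), toPlane (x - g)] : Fin 3 → ℝ × ℝ) i =
      toPlane x := by
    rw [Fin.sum_univ_three]
    ext <;> simp [toPlane] <;> ring
  rw [e1, Fin.sum_univ_three] at h
  simp only [Matrix.cons_val_zero, Matrix.cons_val_one, Matrix.cons_val, smul_eq_mul] at h
  linarith

end DiscreteConvex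

open DiscreteConvex

/-- Let `Ω` be a compact convex subset of the plane, `X = Ω ∩ ℤ²`, and `V` a family of stencils
on `X`. For `x ∈ X` and `e` in the maximal stencil at `x` but not in `V(x)`, the form `P_x^e` is
defined and supported in `X`, and `Conv(V)` is the set of the `u ∈ Conv(X)` such that
`P_x^e(u) ≥ 0` for all such `x` and `e`. -/
theorem mainTheorem3 (Ω : Set (ℝ × ℝ)) (hconv : Convex ℝ Ω) (hcomp : IsCompact Ω)
    (V : grid Ω → Set (ℤ × ℤ)) (hV : IsStencilFamily (grid Ω) V) :
    (∀ x : grid Ω, ∀ e ∈ maxStencil (grid Ω) x \ V x,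
      ∃ f g, IsParents f g e ∧ (x : ℤ × ℤ) + f ∈ grid Ω ∧ (x : ℤ × ℤ) + g ∈ grid Ω) ∧
    convStencil (grid Ω) V =
      {u ∈ convGrid Ω | ∀ x : grid Ω, ∀ e ∈ maxStencil (grid Ω) x \ V x, ∀ f g,
        IsParents f g e → ∀ (he : (x : ℤ × ℤ) + e ∈ grid Ω) (hf : (x : ℤ × ℤ) + f ∈ grid Ω)
          (hg : (x : ℤ × ℤ) + g ∈ grid Ω), 0 ≤ parForm u x e f g he hf hg} := by
  refine ⟨?_, Set.Subset.antisymm ?_ ?_⟩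
  · rintro x e ⟨he, heV⟩
    obtain ⟨f, g, hp⟩ := he.1.exists_isParents fun h1 => heV (unit_mem_stencil hconv hV x he h1)
    have := parents_mem_maxStencil hconv hV x he heV hp
    exact ⟨f, g, hp, this.1.2, this.2.2⟩
  · intro u hu
    -- Extending `u` by 0 to `ℤ²` avoids membership proofs inside the forms; only values on the grid
    -- matter.
    obtain ⟨v, rfl⟩ : ∃ v : ℤ × ℤ → ℝ, u = fun x : grid Ω => v x :=
      ⟨Function.extend Subtype.val u 0,
        funext fun x => (Subtype.val_injective.extend_apply u 0 x).symm⟩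
    refine ⟨mem_convGrid_of_forms_nonneg hconv hcomp
      (fun x e he hx h1 h2 => seg_nonneg_of_mem_convStencil hconv hV hu he hx h1 h2)
      (fun x e f g hp hx h1 h2 h3 => tri_nonneg_of_mem_convStencil hconv hV hu hp hx h1 h2 h3), ?_⟩
    rintro x e ⟨-, heV⟩ f g hp he hf hg
    exact par_nonneg_of_mem_convStencil hconv hV hu hp x.2 he heV
  · rintro u ⟨⟨U, hU, huU⟩, hP⟩ x
    refine ⟨fun e _ he he' => ?_, fun e _ f g hp he hf hg => ?_, fun e he f g hp => ?_⟩
    · simp only [segForm, huU]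
      exact seg_nonneg_of_convexOn hU he he'
    · simp only [triForm, huU]
      exact tri_nonneg_of_convexOn hU hp.2.2 he hf hg
    · exact hP x e ⟨he.1, he.2.1⟩ f g hp
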